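/- Conventions. $\mathbb E$ denotes a uniform average over a finite set, $\log$ is the natural logarithm, and $S$ ranges over the set $\binom{[n]}{m}$ of $m$-element subsets of $[n]$; for $x\in\{0,1\}^n$ and $S=\{i_1<\dots<i_m\}$ put $x_S=(x_{i_1},\dots,x_{i_m})$. The degree $\deg g$ of $g\colon\{0,1\}^m\to\mathbb R$ is its degree as a multilinear polynomial. A degree-$d$ pseudo-density is a function $D\colon\{0,1\}^m\to\mathbb R$ with $\mathbb E_x D(x)=1$ and $\mathbb E_x D(x)g(x)^2\ge 0$ for every $g\colon\{0,1\}^m\to\mathbb R$ with $\deg g\le d/2$; put $\|D\|_\infty=\max_x|D(x)|$. For a nonnegative matrix $N\colon\binom{[n]}{m}\times\{0,1\}^n\to\mathbb R_{+}$ put $\|N\|_\infty=\max_{S,x}N(S,x)$ and $\|N\|_1=\mathbb E_{S,x}N(S,x)$, and let $\mathrm{rk}_{\mathsf{psd}}(N)$ be the smallest $r$ for which there are real symmetric positive semidefinite $r\times r$ matrices $A_S,B_x$ with $N(S,x)=\mathrm{Tr}(A_SB_x)$ for all $S,x$. Finally, put $L_D(N)=\mathbb E_S\,\mathbb E_x\,D(x_S)N(S,x)$.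 Theorem. There is a universal constant $C>0$ such that the following holds. For all integers $m,d\ge 1$, every $\varepsilon\in(0,1]$ and every degree-$d$ pseudo-density $D\colon\{0,1\}^m\to\mathbb R$, the number $$\alpha=\left(\frac{C\varepsilon}{d\,m^2\,\|D\|_\infty}\right)^{d/2}\left(\frac{\varepsilon}{\|D\|_\infty}\right)^{3}$$ is positive, and whenever $n\ge 2m$ and a nonnegative matrix $N\colon\binom{[n]}{m}\times\{0,1\}^n\to\mathbb R_{+}$ satisfies $$\|N\|_\infty\le 1\qquad\text{and}\qquad \frac{\mathrm{rk}_{\mathsf{psd}}(N)^2}{\|N\|_1}\le\alpha\left(\frac{n}{\log n}\right)^{d/2}$$ (the quotient being read as $0$ if $N=0$), we have $L_D(N)\ge-\varepsilon$. -/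

import Mathlib

open scoped BigOperators

noncomputable section

/-- The discrete cube `{0,1}^n`. -/
abbrev Cube (n : ℕ) : Type := Fin n → Bool

/-- The subsets `S ⊆ [n]` with `|S| = m`. -/
abbrev SubsetOfCard (n m : ℕ) : Type := {S : Finset (Fin n) // S.card = m}

/-- The identification `b ↦ 2 b - 1` of `{0,1}` with `{-1,1}`. -/
def boolSign (b : Bool) : ℝ := if b then 1 else -1

/-- The Fourier character `χ_A(x) = ∏_{i ∈ A} x_i`, read on `{0,1}^n`. -/
def cubeChar {n : ℕ} (A : Finset (Fin n)) (x : Cube n) : ℝ := ∏ i ∈ A, boolSign (x i)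

/-- The Fourier coefficient `f̂(A) = E_x f(x) χ_A(x)`. -/
def fourierCoeffCube {n : ℕ} (f : Cube n → ℝ) (A : Finset (Fin n)) : ℝ :=
  𝔼 x, f x * cubeChar A x

/-- The degree of `f` as a multilinear polynomial: `max {|A| : f̂(A) ≠ 0}`
(with value `0` for `f = 0`). -/
def cubeDegree {n : ℕ} (f : Cube n → ℝ) : ℕ :=
  sSup {k : ℕ | ∃ A : Finset (Fin n), fourierCoeffCube f A ≠ 0 ∧ A.card = k}

/-- The set whose supremum is `cubeDegree f` is bounded, so that supremum is not a junk value. -/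
theorem cubeDegree_bddAbove {n : ℕ} (f : Cube n → ℝ) :
    BddAbove {k : ℕ | ∃ A : Finset (Fin n), fourierCoeffCube f A ≠ 0 ∧ A.card = k} := by
  refine ⟨n, ?_⟩
  rintro k ⟨A, -, rfl⟩
  simpa using A.card_le_univ

/-- `D` is a degree-`d` pseudo-density on `{0,1}^m`. -/
def IsPseudoDensity {m : ℕ} (d : ℕ) (D : Cube m → ℝ) : Prop :=
  𝔼 x, D x = 1 ∧
    ∀ g : Cube m → ℝ, (cubeDegree g : ℝ) ≤ (d : ℝ) / 2 → 0 ≤ 𝔼 x, D x * g x ^ 2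

/-- `M` has a rank-`r` psd factorization `M i j = Tr (A i * B j)`, with real symmetric positive
semidefinite `r × r` matrices `A i` and `B j`. -/
def HasPsdFactorization {ι κ : Type} (M : ι → κ → ℝ) (r : ℕ) : Prop :=
  ∃ (A : ι → Matrix (Fin r) (Fin r) ℝ) (B : κ → Matrix (Fin r) (Fin r) ℝ),
    (∀ i, (A i).PosSemidef) ∧ (∀ j, (B j).PosSemidef) ∧
      ∀ i j, M i j = (A i * B j).trace

/-- The psd rank of `M`: the smallest `r` such that `M` has a rank-`r` psd factorization. -/
def psdRank {ι κ : Type} (M : ι → κ → ℝ) : ℕ := sInf {r : ℕ | HasPsdFactorization M r}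

/-- A nonnegative matrix with finitely many rows has a psd factorization,
so its psd rank is attained. -/
theorem hasPsdFactorization_psdRank {ι κ : Type} [Fintype ι] (M : ι → κ → ℝ)
    (hM : ∀ i j, 0 ≤ M i j) : HasPsdFactorization M (psdRank M) := by
  classical
  refine Nat.sInf_mem (s := {r : ℕ | HasPsdFactorization M r}) ⟨Fintype.card ι, ?_⟩
  let e := Fintype.equivFin ι
  refine ⟨fun i => Matrix.diagonal fun k => if k = e i then 1 else 0,
    fun j => Matrix.diagonal fun k => M (e.symm k) j, ?_, ?_, ?_⟩
  · intro i
    refine Matrix.PosSemidef.diagonal fun k => ?_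
    by_cases h : k = e i <;> simp [h]
  · intro j
    exact Matrix.PosSemidef.diagonal fun k => hM _ _
  · intro i j
    simp [Matrix.diagonal_mul_diagonal, Matrix.trace_diagonal]

/-- The average of the entries of `N`; this is the norm `‖N‖₁` of a nonnegative matrix. -/
def entryAverage {ι κ : Type} [Fintype ι] [Fintype κ] (N : ι → κ → ℝ) : ℝ :=
  𝔼 i, 𝔼 j, N i j

/-- The restriction `x_S = (x_{i_1}, …, x_{i_m})`, where `S = {i_1 < ⋯ < i_m}`. -/
def cubeRestrict {n m : ℕ} (S : SubsetOfCard n m) (x : Cube n) : Cube m :=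
  fun k => x (S.1.orderEmbOfFin S.2 k)

/-- The functional `L_D(N) = E_S E_x D(x_S) N(S,x)`. -/
def separatingFunctional {n m : ℕ} (D : Cube m → ℝ) (N : SubsetOfCard n m → Cube n → ℝ) : ℝ :=
  𝔼 S, 𝔼 x, D (cubeRestrict S x) * N S x

end

/-!
A pseudo-density is nonnegative on squares of low-degree functions only, so it has to be shown
that the restriction to a random `m`-set `S` turns arbitrary squares into approximately
low-degree ones. A character `χ_A` with `|A| = t` restricts to one of degree at least `s` with
probability at most `(t * m / n) ^ s`, so a function of degree `t` on the `n`-cube is, for most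
`S`, nearly of low degree in the coordinates in `S`.

A psd factorization `N S x = Tr (A S * B x)` of size `r` can be rescaled by an Auerbach-type
argument so that `A S ≤ r ^ 2`, `E_S A_S ≤ 1` and `Tr (B x) ≤ 2`. With `Λ(x) = E_S D(x_S) A_S`
one has `L_D(N) = E_x Tr (Λ(x) B_x)`, while `M(x) = ‖D‖ - Λ(x)` is positive semidefinite.
Testing `D` against the power `M ^ k`, whose entries have degree at most `k * m`, bounds
`E Tr M ^ (2 * k + 1)` by `ρ * E Tr M ^ (2 * k)` with `ρ` close to `‖D‖`. Comparing power
means transfers this to `E Tr (M B) ≤ c * ρ * E Tr B`, where `c ^ (2 * k)` is at least the ratio of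
the total masses; a `k` of order `log (r / ‖N‖₁) * ‖D‖ / ε` makes `c` close to `1`, and then
`L_D(N) ≥ -ε`.
-/

/-! ### Fourier analysis on the cube -/

section Fourier

open Finset

variable {n : ℕ}

theorem boolSign_mul_self (b : Bool) : boolSign b * boolSign b = 1 := by
  cases b <;> simp [boolSign]

theorem cubeChar_eq_prod_ite (A : Finset (Fin n)) (x : Cube n) :
    cubeChar A x = ∏ i, if i ∈ A then boolSign (x i) else 1 := by
  simp [cubeChar, prod_ite_mem]

theorem cubeChar_mul (A B : Finset (Fin n)) (x : Cube n) :
    cubeChar A x * cubeChar B x = cubeChar (symmDiff A B) x := by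
  simp only [cubeChar_eq_prod_ite, ← prod_mul_distrib]
  refine prod_congr rfl fun i _ => ?_
  by_cases hA : i ∈ A <;> by_cases hB : i ∈ B <;>
    simp [mem_symmDiff, hA, hB, boolSign_mul_self]

theorem expect_cubeChar (A : Finset (Fin n)) :
    𝔼 x : Cube n, cubeChar A x = if A = ∅ then (1 : ℝ) else 0 := by
  split_ifs with hA
  · simp [hA, cubeChar]
  · obtain ⟨i, hi⟩ := nonempty_iff_ne_empty.mpr hA
    have hsum : ∑ x : Cube n, cubeChar A x
        = ∏ i, ∑ b : Bool, if i ∈ A then boolSign b else 1 := by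
      simp only [cubeChar_eq_prod_ite, prod_univ_sum, Fintype.piFinset_univ]
    rw [Fintype.expect_eq_sum_div_card, hsum, prod_eq_zero (mem_univ i) (by simp [hi, boolSign]),
      zero_div]

theorem expect_cubeChar_mul (A B : Finset (Fin n)) :
    𝔼 x : Cube n, cubeChar A x * cubeChar B x = if A = B then (1 : ℝ) else 0 := by
  simp only [cubeChar_mul, expect_cubeChar, ← bot_eq_empty, symmDiff_eq_bot]

theorem expect_sum_cubeChar_sq (s : Finset (Finset (Fin n))) (c : Finset (Fin n) → ℝ) :
    𝔼 x : Cube n, (∑ A ∈ s, c A * cubeChar A x) ^ 2 = ∑ A ∈ s, c A ^ 2 := by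
  calc 𝔼 x : Cube n, (∑ A ∈ s, c A * cubeChar A x) ^ 2
      = ∑ A ∈ s, ∑ B ∈ s, c A * c B * 𝔼 x : Cube n, cubeChar A x * cubeChar B x := by
        simp only [mul_expect, ← expect_sum_comm, pow_two, sum_mul_sum]
        exact expect_congr rfl fun x _ => sum_congr rfl fun A _ => sum_congr rfl fun B _ => by ring
    _ = ∑ A ∈ s, c A ^ 2 := by
        simp +contextual [expect_cubeChar_mul, pow_two]

theorem sum_cubeChar_mul_cubeChar (x y : Cube n) :
    ∑ A : Finset (Fin n), cubeChar A x * cubeChar A y = if x = y then (2 : ℝ) ^ n else 0 := by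
  have hprod : ∑ A : Finset (Fin n), cubeChar A x * cubeChar A y
      = ∏ i, (1 + boolSign (x i) * boolSign (y i)) := by
    simp only [prod_one_add, powerset_univ, cubeChar, prod_mul_distrib]
  rw [hprod]
  split_ifs with hxy
  · simp only [hxy, boolSign_mul_self]
    norm_num
  · obtain ⟨i, hi⟩ := Function.ne_iff.mp hxy
    refine prod_eq_zero (mem_univ i) ?_
    cases hx : x i <;> cases hy : y i <;> simp_all [boolSign]

theorem sum_fourierCoeffCube_mul_cubeChar (f : Cube n → ℝ) (x : Cube n) :
    ∑ A, fourierCoeffCube f A * cubeChar A x = f x := by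
  simp only [fourierCoeffCube, expect_mul, mul_assoc]
  rw [← expect_sum_comm]
  simp only [← mul_sum, sum_cubeChar_mul_cubeChar, Fintype.expect_eq_sum_div_card]
  simp

theorem expect_sq_eq_sum_fourierCoeffCube_sq (f : Cube n → ℝ) :
    𝔼 x, f x ^ 2 = ∑ A, fourierCoeffCube f A ^ 2 := by
  simp only [← expect_sum_cubeChar_sq, sum_fourierCoeffCube_mul_cubeChar]

theorem fourierCoeffCube_add (f g : Cube n → ℝ) (A : Finset (Fin n)) :
    fourierCoeffCube (f + g) A = fourierCoeffCube f A + fourierCoeffCube g A := by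
  simp only [fourierCoeffCube, Pi.add_apply, add_mul, expect_add_distrib]

theorem fourierCoeffCube_smul (a : ℝ) (f : Cube n → ℝ) (A : Finset (Fin n)) :
    fourierCoeffCube (a • f) A = a * fourierCoeffCube f A := by
  simp only [fourierCoeffCube, Pi.smul_apply, smul_eq_mul, mul_assoc, mul_expect]

/-- The functions on the cube of degree at most `t`, as the span of the characters of the sets of
size at most `t`: this form makes closure under products and restrictions immediate, which
`cubeDegree` does not. -/
def lowDegree (n t : ℕ) : Submodule ℝ (Cube n → ℝ) :=
  Submodule.span ℝ (cubeChar '' {A : Finset (Fin n) | #A ≤ t})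

theorem cubeChar_mem_lowDegree {t : ℕ} {A : Finset (Fin n)} (hA : #A ≤ t) :
    cubeChar A ∈ lowDegree n t :=
  Submodule.subset_span ⟨A, hA, rfl⟩

theorem fourierCoeffCube_eq_zero_of_mem_lowDegree {t : ℕ} {f : Cube n → ℝ}
    (hf : f ∈ lowDegree n t) {B : Finset (Fin n)} (hB : t < #B) : fourierCoeffCube f B = 0 := by
  induction hf using Submodule.span_induction with
  | mem f hf =>
    obtain ⟨A, hA, rfl⟩ := hf
    have hAB : A ≠ B := by
      rintro rfl
      exact hB.not_ge hA
    simp only [fourierCoeffCube, expect_cubeChar_mul, if_neg hAB]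
  | zero => simp [fourierCoeffCube]
  | add f g _ _ hf hg => rw [fourierCoeffCube_add, hf, hg, add_zero]
  | smul a f _ hf => rw [fourierCoeffCube_smul, hf, mul_zero]

theorem cubeDegree_le_of_mem_lowDegree {t : ℕ} {f : Cube n → ℝ} (hf : f ∈ lowDegree n t) :
    cubeDegree f ≤ t := by
  refine csSup_le' ?_
  rintro k ⟨A, hA, rfl⟩
  exact not_lt.mp fun h => hA (fourierCoeffCube_eq_zero_of_mem_lowDegree hf h)

theorem const_mem_lowDegree (t : ℕ) (a : ℝ) : (fun _ => a) ∈ lowDegree n t := by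
  convert (lowDegree n t).smul_mem a (cubeChar_mem_lowDegree (A := ∅) (by simp)) using 1
  funext x
  simp [cubeChar]

theorem mul_mem_lowDegree {a b : ℕ} {f g : Cube n → ℝ} (hf : f ∈ lowDegree n a)
    (hg : g ∈ lowDegree n b) : f * g ∈ lowDegree n (a + b) := by
  have hfg := Submodule.mul_mem_mul hf hg
  rw [lowDegree, lowDegree, Submodule.span_mul_span] at hfg
  refine Submodule.span_le.mpr ?_ hfg
  rintro _ ⟨_, ⟨A, hA, rfl⟩, _, ⟨B, hB, rfl⟩, rfl⟩
  have hcard : #(symmDiff A B) ≤ a + b :=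
    (card_le_card symmDiff_le_sup).trans ((card_union_le A B).trans (Nat.add_le_add hA hB))
  have hmul : cubeChar A * cubeChar B = cubeChar (symmDiff A B) := funext (cubeChar_mul A B)
  simpa only [hmul, SetLike.mem_coe] using cubeChar_mem_lowDegree hcard

theorem matrix_pow_mem_lowDegree {ι : Type*} [Fintype ι] [DecidableEq ι] {t : ℕ}
    {M : Cube n → Matrix ι ι ℝ} (hM : ∀ i j, (fun x => M x i j) ∈ lowDegree n t) (k : ℕ)
    (i j : ι) : (fun x => (M x ^ k) i j) ∈ lowDegree n (k * t) := by
  induction k generalizing j with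
  | zero => simpa using const_mem_lowDegree (0 * t) ((1 : Matrix ι ι ℝ) i j)
  | succ k ih =>
    have hsum : (fun x => (M x ^ (k + 1)) i j)
        = ∑ l, (fun x => (M x ^ k) i l) * (fun x => M x l j) := by
      funext x
      simp [pow_succ, Matrix.mul_apply]
    rw [hsum, Nat.succ_mul]
    exact Submodule.sum_mem _ fun l _ => mul_mem_lowDegree (ih l) (hM l j)

end Fourier

/-! ### Restriction to a set of coordinates -/

section Restriction

open Finset Function

variable {n m : ℕ}

theorem cubeChar_comp (e : Fin m ↪ Fin n) (A : Finset (Fin m)) (x : Cube n) :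
    cubeChar A (x ∘ e) = cubeChar (A.map e) x := by
  simp [cubeChar, prod_map]

theorem comp_embedding_mem_lowDegree (e : Fin m ↪ Fin n) (D : Cube m → ℝ) :
    (fun x : Cube n => D (x ∘ e)) ∈ lowDegree n m := by
  have hsum : (fun x : Cube n => D (x ∘ e))
      = ∑ A, fourierCoeffCube D A • cubeChar (A.map e) := by
    funext x
    simp [← sum_fourierCoeffCube_mul_cubeChar D, cubeChar_comp]
  rw [hsum]
  refine Submodule.sum_mem _ fun A _ => Submodule.smul_mem _ _ (cubeChar_mem_lowDegree ?_)
  simpa using A.card_le_univ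

theorem extend_comp_extend {α β γ : Type*} {e : α → β} (he : Injective e) (y : α → γ) (x : β → γ) :
    extend e (x ∘ e) (extend e y x) = x := by
  funext i
  by_cases hi : ∃ k, e k = i
  · obtain ⟨k, rfl⟩ := hi
    exact he.extend_apply _ _ k
  · rw [extend_apply' _ _ _ hi, extend_apply' _ _ _ hi]

theorem expect_expect_extend (e : Fin m ↪ Fin n) (F : Cube n → ℝ) :
    𝔼 x : Cube n, 𝔼 y : Cube m, F (extend e y x) = 𝔼 x, F x := by
  have hinv : Involutive fun p : Cube n × Cube m => (extend e p.2 p.1, p.1 ∘ e) := fun p =>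
    Prod.ext (extend_comp_extend e.injective p.2 p.1) (extend_comp e.injective p.2 p.1)
  calc 𝔼 x : Cube n, 𝔼 y : Cube m, F (extend e y x)
      = 𝔼 p : Cube n × Cube m, F (extend e p.2 p.1) := by
        rw [← univ_product_univ, expect_product]
    _ = 𝔼 p : Cube n × Cube m, F p.1 := Fintype.expect_equiv hinv.toPerm _ _ fun _ => rfl
    _ = 𝔼 x, F x := by
        rw [← univ_product_univ, expect_product]
        simp only [Fintype.expect_const]

theorem map_preimage_eq_inter (e : Fin m ↪ Fin n) (A : Finset (Fin n)) :
    (A.preimage e e.injective.injOn).map e = A ∩ univ.map e := by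
  ext i
  simp only [mem_map, mem_preimage, mem_inter, mem_univ, true_and]
  constructor
  · rintro ⟨k, hk, rfl⟩
    exact ⟨hk, k, rfl⟩
  · rintro ⟨hi, k, rfl⟩
    exact ⟨k, hi, rfl⟩

theorem cubeChar_extend (e : Fin m ↪ Fin n) (A : Finset (Fin n)) (x : Cube n) (y : Cube m) :
    cubeChar A (extend e y x) =
      cubeChar (A \ univ.map e) x * cubeChar (A.preimage e e.injective.injOn) y := by
  have hin : cubeChar (A.preimage e e.injective.injOn) y
      = cubeChar (A ∩ univ.map e) (extend e y x) := by
    rw [← map_preimage_eq_inter, ← cubeChar_comp, extend_comp e.injective]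
  have hout : cubeChar (A \ univ.map e) x = cubeChar (A \ univ.map e) (extend e y x) := by
    refine prod_congr rfl fun i hi => ?_
    rw [extend_apply']
    simpa using (mem_sdiff.mp hi).2
  rw [hin, hout, mul_comm]
  exact (prod_inter_mul_prod_sdiff A _ _).symm

/-- The part of `f` spanned by the characters `cubeChar A` with `s ≤ #(A ∩ S)`, that is, of degree
at least `s` in the coordinates in `S`. -/
noncomputable def highPart (s : ℕ) (S : Finset (Fin n)) : (Cube n → ℝ) →ₗ[ℝ] (Cube n → ℝ) where
  toFun f x := ∑ A with s ≤ #(A ∩ S), fourierCoeffCube f A * cubeChar A x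
  map_add' f g := by
    funext x
    simp only [fourierCoeffCube_add, add_mul, sum_add_distrib, Pi.add_apply]
  map_smul' a f := by
    funext x
    simp only [fourierCoeffCube_smul, mul_assoc, mul_sum, RingHom.id_apply, Pi.smul_apply,
      smul_eq_mul]

theorem highPart_apply (s : ℕ) (S : Finset (Fin n)) (f : Cube n → ℝ) (x : Cube n) :
    highPart s S f x = ∑ A with s ≤ #(A ∩ S), fourierCoeffCube f A * cubeChar A x :=
  rfl

theorem sub_highPart_apply (s : ℕ) (S : Finset (Fin n)) (f : Cube n → ℝ) (x : Cube n) :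
    (f - highPart s S f) x = ∑ A with #(A ∩ S) < s, fourierCoeffCube f A * cubeChar A x := by
  rw [Pi.sub_apply, ← sum_fourierCoeffCube_mul_cubeChar f x, highPart_apply, sub_eq_iff_eq_add']
  simp only [← not_le]
  exact (sum_filter_add_sum_filter_not _ _ _).symm

theorem sub_highPart_extend_mem_lowDegree (e : Fin m ↪ Fin n) (t : ℕ) (f : Cube n → ℝ)
    (x : Cube n) :
    (fun y => (f - highPart (t + 1) (univ.map e) f) (extend e y x)) ∈ lowDegree m t := by
  have hsum : (fun y => (f - highPart (t + 1) (univ.map e) f) (extend e y x))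
      = ∑ A with #(A ∩ univ.map e) < t + 1,
        (fourierCoeffCube f A * cubeChar (A \ univ.map e) x) •
          cubeChar (A.preimage e e.injective.injOn) := by
    funext y
    simp only [sub_highPart_apply, cubeChar_extend, Finset.sum_apply, Pi.smul_apply, smul_eq_mul,
      mul_assoc]
  rw [hsum]
  refine Submodule.sum_mem _ fun A hA => Submodule.smul_mem _ _ (cubeChar_mem_lowDegree ?_)
  rw [← card_map e, map_preimage_eq_inter]
  exact Nat.lt_succ_iff.mp (mem_filter.mp hA).2

variable {d : ℕ} {D : Cube m → ℝ}

theorem IsPseudoDensity.expect_mul_sq_nonneg (hD : IsPseudoDensity d D) {g : Cube m → ℝ}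
    (hg : g ∈ lowDegree m (d / 2)) : 0 ≤ 𝔼 y, D y * g y ^ 2 :=
  hD.2 g ((Nat.cast_le.mpr (cubeDegree_le_of_mem_lowDegree hg)).trans Nat.cast_div_le)

theorem IsPseudoDensity.one_le_norm (hD : IsPseudoDensity d D) : 1 ≤ ‖D‖ := by
  calc 1 = 𝔼 x, D x := hD.1.symm
    _ ≤ 𝔼 _x : Cube m, ‖D‖ :=
        expect_le_expect fun x _ => (le_abs_self _).trans (norm_le_pi_norm D x)
    _ = ‖D‖ := Fintype.expect_const _

theorem IsPseudoDensity.expect_comp_mul_sub_highPart_sq_nonneg (hD : IsPseudoDensity d D)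
    (e : Fin m ↪ Fin n) (f : Cube n → ℝ) :
    0 ≤ 𝔼 x : Cube n, D (x ∘ e) * (f - highPart (d / 2 + 1) (univ.map e) f) x ^ 2 := by
  rw [← expect_expect_extend e]
  refine expect_nonneg fun x _ => ?_
  simp only [extend_comp e.injective]
  exact hD.expect_mul_sq_nonneg (sub_highPart_extend_mem_lowDegree e (d / 2) f x)

theorem abs_sq_sub_sub_sq_le (a b : ℝ) {θ : ℝ} (hθ : 0 < θ) :
    |a ^ 2 - (a - b) ^ 2| ≤ θ * a ^ 2 + (1 / θ + 1) * b ^ 2 := by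
  have hamgm : 2 * |a * b| ≤ θ * a ^ 2 + 1 / θ * b ^ 2 := by
    have hsq : 0 ≤ θ * (|a| - |b| / θ) ^ 2 := by positivity
    have hexpand : θ * (|a| - |b| / θ) ^ 2 = θ * a ^ 2 + 1 / θ * b ^ 2 - 2 * |a * b| := by
      rw [abs_mul, ← sq_abs a, ← sq_abs b]
      field_simp
      ring
    linarith
  calc |a ^ 2 - (a - b) ^ 2| = |2 * (a * b) - b ^ 2| := by ring_nf
    _ ≤ |2 * (a * b)| + |b ^ 2| := abs_sub _ _
    _ = 2 * |a * b| + b ^ 2 := by rw [abs_mul, abs_two, abs_sq]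
    _ ≤ θ * a ^ 2 + (1 / θ + 1) * b ^ 2 := by linarith

theorem IsPseudoDensity.neg_le_expect_comp_mul_sq (hD : IsPseudoDensity d D) (e : Fin m ↪ Fin n)
    (f : Cube n → ℝ) {θ : ℝ} (hθ : 0 < θ) :
    -(‖D‖ * (θ * 𝔼 x, f x ^ 2
        + (1 / θ + 1) * 𝔼 x, highPart (d / 2 + 1) (univ.map e) f x ^ 2))
      ≤ 𝔼 x : Cube n, D (x ∘ e) * f x ^ 2 := by
  set h := highPart (d / 2 + 1) (univ.map e) f
  have hpointwise (x : Cube n) : -(‖D‖ * (θ * f x ^ 2 + (1 / θ + 1) * h x ^ 2))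
      ≤ D (x ∘ e) * f x ^ 2 - D (x ∘ e) * (f - h) x ^ 2 := by
    rw [← mul_sub]
    refine (abs_le.mp ?_).1
    rw [abs_mul]
    exact mul_le_mul (norm_le_pi_norm D _) (abs_sq_sub_sub_sq_le _ _ hθ) (abs_nonneg _)
      (norm_nonneg _)
  have hexpect := expect_le_expect fun x (_ : x ∈ univ) => hpointwise x
  simp only [expect_neg_distrib, expect_sub_distrib, ← mul_expect, expect_add_distrib] at hexpect
  linarith [hD.expect_comp_mul_sub_highPart_sq_nonneg e f]

end Restriction

/-! ### Random sets of coordinates -/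

section RandomSubset

open Finset

variable {n m : ℕ}

theorem choose_mul_pow_le_choose_mul_pow (hmn : m ≤ n) (s : ℕ) :
    m.choose s * n ^ s ≤ n.choose s * m ^ s := by
  induction s with
  | zero => simp
  | succ s ih =>
    have hfactor : (m - s) * n ≤ (n - s) * m := by
      rw [Nat.sub_mul, Nat.sub_mul, Nat.mul_comm n m]
      exact Nat.sub_le_sub_left (Nat.mul_le_mul_left s hmn) _
    refine Nat.le_of_mul_le_mul_right (c := s + 1) ?_ s.succ_pos
    calc m.choose (s + 1) * n ^ (s + 1) * (s + 1)
        = m.choose (s + 1) * (s + 1) * n ^ (s + 1) := by ring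
      _ = m.choose s * n ^ s * ((m - s) * n) := by rw [Nat.choose_succ_right_eq]; ring
      _ ≤ n.choose s * m ^ s * ((n - s) * m) := Nat.mul_le_mul ih hfactor
      _ = n.choose (s + 1) * (s + 1) * m ^ (s + 1) := by rw [Nat.choose_succ_right_eq]; ring
      _ = n.choose (s + 1) * m ^ (s + 1) * (s + 1) := by ring

theorem card_filter_subset_subsetOfCard (B : Finset (Fin n)) (hB : #B ≤ m) :
    #{S : SubsetOfCard n m | B ⊆ S.1} = (n - #B).choose (m - #B) := by
  have hmap : ({S : SubsetOfCard n m | B ⊆ S.1} : Finset _).map (Function.Embedding.subtype _)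
      = {S ∈ powersetCard m (univ : Finset (Fin n)) | B ⊆ S} := by
    ext S
    simp [and_comm]
  rw [← card_map, hmap, card_filter_powersetCard_subset B univ m (subset_univ B) hB, card_univ,
    Fintype.card_fin]

theorem expect_ite_subset_le (hmn : m ≤ n) (B : Finset (Fin n)) :
    𝔼 S : SubsetOfCard n m, (if B ⊆ S.1 then (1 : ℝ) else 0) ≤ ((m : ℝ) / n) ^ #B := by
  by_cases hB : #B ≤ m
  · have hnB : (0 : ℝ) < (n : ℝ) ^ #B := by
      rcases B.eq_empty_or_nonempty with rfl | ⟨i, -⟩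
      · simp
      · have := i.pos
        positivity
    have hcount : n.choose #B * ((n - #B).choose (m - #B) * n ^ #B)
        ≤ n.choose #B * (n.choose m * m ^ #B) := by
      calc n.choose #B * ((n - #B).choose (m - #B) * n ^ #B)
          = n.choose m * (m.choose #B * n ^ #B) := by
            rw [← mul_assoc, ← Nat.choose_mul hB, mul_assoc]
        _ ≤ n.choose m * (n.choose #B * m ^ #B) :=
            Nat.mul_le_mul_left _ (choose_mul_pow_le_choose_mul_pow hmn #B)
        _ = n.choose #B * (n.choose m * m ^ #B) := by ring
    have hcancel := Nat.le_of_mul_le_mul_left hcount (Nat.choose_pos (hB.trans hmn))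
    rw [Fintype.expect_eq_sum_div_card, sum_boole, card_filter_subset_subsetOfCard B hB,
      Fintype.card_finset_len, Fintype.card_fin, div_pow,
      div_le_div_iff₀ (Nat.cast_pos.mpr (Nat.choose_pos hmn)) hnB, mul_comm ((m : ℝ) ^ #B)]
    exact_mod_cast hcancel
  · have hempty (S : SubsetOfCard n m) : ¬B ⊆ S.1 := fun h =>
      hB ((card_le_card h).trans_eq S.2)
    simp only [hempty, if_false, expect_const_zero]
    positivity

theorem expect_ite_le_card_inter_le (hmn : m ≤ n) (s : ℕ) (A : Finset (Fin n)) :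
    𝔼 S : SubsetOfCard n m, (if s ≤ #(A ∩ S.1) then (1 : ℝ) else 0) ≤ (#A * (m / n) : ℝ) ^ s := by
  have hunion (S : SubsetOfCard n m) : (if s ≤ #(A ∩ S.1) then (1 : ℝ) else 0)
      ≤ ∑ B ∈ powersetCard s A, if B ⊆ S.1 then (1 : ℝ) else 0 := by
    have hnonneg : ∀ B ∈ powersetCard s A, (0 : ℝ) ≤ if B ⊆ S.1 then 1 else 0 :=
      fun B _ => by split_ifs <;> norm_num
    split_ifs with hs
    · obtain ⟨B, hBAS, hBs⟩ := exists_subset_card_eq hs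
      obtain ⟨hBA, hBS⟩ := subset_inter_iff.mp hBAS
      simpa only [if_pos hBS] using
        single_le_sum hnonneg (mem_powersetCard.mpr ⟨hBA, hBs⟩)
    · exact sum_nonneg hnonneg
  calc 𝔼 S : SubsetOfCard n m, (if s ≤ #(A ∩ S.1) then (1 : ℝ) else 0)
      ≤ 𝔼 S : SubsetOfCard n m, ∑ B ∈ powersetCard s A, if B ⊆ S.1 then (1 : ℝ) else 0 :=
        expect_le_expect fun S _ => hunion S
    _ = ∑ B ∈ powersetCard s A, 𝔼 S : SubsetOfCard n m, if B ⊆ S.1 then (1 : ℝ) else 0 :=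
        expect_sum_comm _ _ _
    _ ≤ ∑ _B ∈ powersetCard s A, ((m : ℝ) / n) ^ s :=
        sum_le_sum fun B hB => (expect_ite_subset_le hmn B).trans_eq <| by
          rw [(mem_powersetCard.mp hB).2]
    _ = (#A).choose s * ((m : ℝ) / n) ^ s := by simp
    _ ≤ (#A : ℝ) ^ s * ((m : ℝ) / n) ^ s := by
        gcongr
        exact_mod_cast Nat.choose_le_pow _ _
    _ = (#A * (m / n) : ℝ) ^ s := (mul_pow _ _ _).symm

theorem expect_expect_highPart_sq_le (hmn : m ≤ n) (s : ℕ) {t : ℕ} {f : Cube n → ℝ}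
    (hf : f ∈ lowDegree n t) :
    𝔼 S : SubsetOfCard n m, 𝔼 x, highPart s S.1 f x ^ 2
      ≤ (t * (m / n) : ℝ) ^ s * 𝔼 x, f x ^ 2 := by
  have hparseval : 𝔼 S : SubsetOfCard n m, 𝔼 x, highPart s S.1 f x ^ 2
      = ∑ A, (𝔼 S : SubsetOfCard n m, if s ≤ #(A ∩ S.1) then (1 : ℝ) else 0)
          * fourierCoeffCube f A ^ 2 := by
    simp only [highPart_apply, expect_sum_cubeChar_sq]
    simp only [sum_filter, expect_sum_comm, expect_mul, ite_mul, one_mul, zero_mul]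
  rw [hparseval, expect_sq_eq_sum_fourierCoeffCube_sq, mul_sum]
  refine sum_le_sum fun A _ => ?_
  rcases lt_or_ge t #A with hA | hA
  · simp [fourierCoeffCube_eq_zero_of_mem_lowDegree hf hA]
  · refine mul_le_mul_of_nonneg_right ?_ (sq_nonneg _)
    refine (expect_ite_le_card_inter_le hmn s A).trans ?_
    gcongr

end RandomSubset

/-! ### Rescaling a psd factorization -/

section Matrices

open Matrix
open scoped MatrixOrder

variable {ι σ τ : Type*} [Fintype ι]

theorem trace_conjTranspose_mul_self_eq_sum (G : Matrix ι ι ℝ) :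
    (Gᴴ * G).trace = ∑ i, ∑ j, G i j ^ 2 := by
  rw [Finset.sum_comm]
  simp only [trace, diag_apply, mul_apply, conjTranspose_apply, star_trivial, sq]

theorem trace_conjTranspose_mul_self_mul (G B : Matrix ι ι ℝ) :
    (Gᴴ * G * B).trace = ∑ i, G i ⬝ᵥ B *ᵥ G i := by
  rw [Matrix.mul_assoc, trace_mul_comm]
  simp only [trace, diag_apply, mul_apply, conjTranspose_apply, star_trivial, dotProduct_mulVec]
  rfl

theorem dotProduct_conjTranspose_mul_mul_mulVec (G A : Matrix ι ι ℝ) (v : ι → ℝ) :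
    v ⬝ᵥ (Gᴴ * A * G) *ᵥ v = (G *ᵥ v) ⬝ᵥ A *ᵥ (G *ᵥ v) := by
  rw [← mulVec_mulVec, ← mulVec_mulVec, dotProduct_mulVec v, vecMul_conjTranspose, star_trivial,
    star_trivial]

theorem dotProduct_conjTranspose_mul_self_mulVec (G : Matrix ι ι ℝ) (v : ι → ℝ) :
    v ⬝ᵥ (Gᴴ * G) *ᵥ v = (G *ᵥ v) ⬝ᵥ (G *ᵥ v) := by
  rw [← mulVec_mulVec, dotProduct_mulVec, vecMul_conjTranspose, star_trivial, star_trivial]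

theorem mulVec_dotProduct_mulVec_self (G : Matrix ι ι ℝ) (v : ι → ℝ) :
    (G *ᵥ v) ⬝ᵥ (G *ᵥ v) = ∑ i, (G i ⬝ᵥ v) ^ 2 := by
  simp only [sq]
  rfl

theorem exists_eq_conjTranspose_mul_self {A : Matrix ι ι ℝ} (hA : A.PosSemidef) :
    ∃ G : Matrix ι ι ℝ, A = Gᴴ * G := by
  classical exact CStarAlgebra.nonneg_iff_eq_star_mul_self.mp hA.nonneg

theorem trace_mul_nonneg {A B : Matrix ι ι ℝ} (hA : A.PosSemidef) (hB : B.PosSemidef) :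
    0 ≤ (A * B).trace := by
  obtain ⟨G, rfl⟩ := exists_eq_conjTranspose_mul_self hA
  rw [trace_conjTranspose_mul_self_mul]
  exact Finset.sum_nonneg fun i _ => hB.dotProduct_mulVec_nonneg (G i)

theorem trace_mul_le_trace_mul {A₁ A₂ B : Matrix ι ι ℝ} (hA : A₁ ≤ A₂) (hB : B.PosSemidef) :
    (A₁ * B).trace ≤ (A₂ * B).trace := by
  rw [← sub_nonneg, ← trace_sub, ← Matrix.sub_mul]
  exact trace_mul_nonneg (le_iff.mp hA) hB

theorem dotProduct_mulVec_le_trace_mul {A : Matrix ι ι ℝ} (hA : A.PosSemidef) (v : ι → ℝ) :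
    v ⬝ᵥ A *ᵥ v ≤ A.trace * (v ⬝ᵥ v) := by
  obtain ⟨G, rfl⟩ := exists_eq_conjTranspose_mul_self hA
  have hvv : v ⬝ᵥ v = ∑ j, v j ^ 2 := by simp only [dotProduct, sq]
  rw [dotProduct_conjTranspose_mul_self_mulVec, mulVec_dotProduct_mulVec_self,
    trace_conjTranspose_mul_self_eq_sum, hvv, Finset.sum_mul]
  exact Finset.sum_le_sum fun i _ => Finset.sum_mul_sq_le_sq_mul_sq _ _ _

theorem isCompact_setOf_dotProduct_self_le_one : IsCompact {w : ι → ℝ | w ⬝ᵥ w ≤ 1} := by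
  have himage : {w : ι → ℝ | w ⬝ᵥ w ≤ 1}
      = WithLp.ofLp '' Metric.closedBall (0 : EuclideanSpace ℝ ι) 1 := by
    ext w
    have hnorm : ‖WithLp.toLp 2 w‖ ^ 2 = w ⬝ᵥ w := by
      rw [EuclideanSpace.real_norm_sq_eq]
      simp only [dotProduct, sq]
    constructor
    · intro hw
      refine ⟨WithLp.toLp 2 w, ?_, rfl⟩
      rw [mem_closedBall_zero_iff, ← sq_le_one_iff₀ (norm_nonneg _), hnorm]
      exact hw
    · rintro ⟨w, hw, rfl⟩
      rw [Set.mem_ofPred_eq, ← hnorm, sq_le_one_iff₀ (norm_nonneg _)]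
      exact mem_closedBall_zero_iff.mp hw
  rw [himage]
  exact (isCompact_closedBall 0 1).image (PiLp.continuous_ofLp 2 _)

/- Auerbach's argument: among the matrices with rows in `Ω`, one with `|det|` maximal works, by
Cramer's rule. -/
theorem exists_forall_mem_eq_sum_smul [DecidableEq ι] {Ω : Set (ι → ℝ)} (hΩ : IsCompact Ω)
    {U₀ : Matrix ι ι ℝ} (hU₀ : ∀ i, U₀ i ∈ Ω) (hdet : U₀.det ≠ 0) :
    ∃ U : Matrix ι ι ℝ, (∀ i, U i ∈ Ω) ∧
      ∀ u ∈ Ω, ∃ c : ι → ℝ, (∀ i, |c i| ≤ 1) ∧ u = ∑ i, c i • U i := by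
  obtain ⟨U, hU, hmax⟩ : ∃ U : Matrix ι ι ℝ, U ∈ Set.univ.pi (fun _ => Ω) ∧
      IsMaxOn (fun U : Matrix ι ι ℝ => |U.det|) (Set.univ.pi fun _ => Ω) U :=
    (isCompact_univ_pi fun _ => hΩ).exists_isMaxOn ⟨U₀, fun i _ => hU₀ i⟩
      continuous_id.matrix_det.abs.continuousOn
  have hpos : 0 < |U.det| := (abs_pos.mpr hdet).trans_le (hmax fun i _ => hU₀ i)
  refine ⟨U, fun i => hU i trivial, fun u hu => ?_⟩
  have hsum : u = ∑ i, (u ᵥ* U⁻¹) i • U i := by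
    rw [← vecMul_eq_sum, vecMul_vecMul, nonsing_inv_mul U (abs_pos.mp hpos).isUnit, vecMul_one]
  refine ⟨u ᵥ* U⁻¹, fun i => ?_, hsum⟩
  have hcramer : (U.updateRow i u).det = (u ᵥ* U⁻¹) i * U.det := by
    conv_lhs => rw [hsum]
    exact det_updateRow_sum U i _
  have hrows : U.updateRow i u ∈ Set.univ.pi fun _ : ι => Ω := by
    intro j _
    rcases eq_or_ne j i with rfl | hij
    · rwa [updateRow_self]
    · rw [updateRow_ne hij]
      exact hU j trivial
  refine le_of_mul_le_mul_right ?_ hpos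
  rw [one_mul, ← abs_mul, ← hcramer]
  exact hmax hrows

theorem dotProduct_self_le_of_forall {v : ι → ℝ} {a : ℝ}
    (h : ∀ w : ι → ℝ, w ⬝ᵥ w ≤ 1 → (w ⬝ᵥ v) ^ 2 ≤ a) : v ⬝ᵥ v ≤ a := by
  have hnonneg : 0 ≤ v ⬝ᵥ v := dotProduct_self_star_nonneg v
  rcases hnonneg.eq_or_lt with hv | hv
  · simpa [← hv] using h 0
  · have hsqrt : (√(v ⬝ᵥ v))⁻¹ ^ 2 * (v ⬝ᵥ v) = 1 := by
      rw [inv_pow, Real.sq_sqrt hv.le, inv_mul_cancel₀ hv.ne']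
    have hunit : ((√(v ⬝ᵥ v))⁻¹ • v) ⬝ᵥ ((√(v ⬝ᵥ v))⁻¹ • v) = 1 := by
      rw [smul_dotProduct, dotProduct_smul, smul_smul, ← sq, smul_eq_mul, hsqrt]
    have hv := h _ hunit.le
    rwa [smul_dotProduct, smul_eq_mul, mul_pow, sq (v ⬝ᵥ v), ← mul_assoc, hsqrt, one_mul] at hv

theorem dotProduct_mulVec_conjTranspose_mulVec_le {G B : Matrix ι ι ℝ} (hB : B.PosSemidef)
    (hGB : (Gᴴ * G * B).trace ≤ 1) {w : ι → ℝ} (hw : w ⬝ᵥ w ≤ 1) :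
    (Gᴴ *ᵥ w) ⬝ᵥ B *ᵥ (Gᴴ *ᵥ w) ≤ 1 := by
  have hpsd := hB.mul_mul_conjTranspose_same G
  rw [Matrix.mul_assoc, trace_mul_comm] at hGB
  calc (Gᴴ *ᵥ w) ⬝ᵥ B *ᵥ (Gᴴ *ᵥ w) = w ⬝ᵥ (G * B * Gᴴ) *ᵥ w := by
        rw [← dotProduct_conjTranspose_mul_mul_mulVec, conjTranspose_conjTranspose]
    _ ≤ (G * B * Gᴴ).trace * (w ⬝ᵥ w) := dotProduct_mulVec_le_trace_mul hpsd w
    _ ≤ 1 := mul_le_one₀ hGB (dotProduct_self_star_nonneg w) hw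

theorem sq_dotProduct_le_of_eq_sum_smul {U : Matrix ι ι ℝ} {u : ι → ℝ} {c : ι → ℝ}
    (hc : ∀ i, |c i| ≤ 1) (hu : u = ∑ i, c i • U i) (v : ι → ℝ) :
    (u ⬝ᵥ v) ^ 2 ≤ v ⬝ᵥ ((Fintype.card ι : ℝ) • (Uᴴ * U)) *ᵥ v := by
  have hsum : u ⬝ᵥ v = ∑ i, c i * (U i ⬝ᵥ v) := by
    simp only [hu, sum_dotProduct, smul_dotProduct, smul_eq_mul]
  have hcsq : ∑ i, c i ^ 2 ≤ Fintype.card ι := by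
    simpa using Finset.sum_le_card_nsmul Finset.univ (fun i => c i ^ 2) 1 fun i _ =>
      (sq_le_one_iff_abs_le_one _).mpr (hc i)
  rw [smul_mulVec, dotProduct_smul, dotProduct_conjTranspose_mul_self_mulVec,
    mulVec_dotProduct_mulVec_self, smul_eq_mul, hsum]
  exact (Finset.sum_mul_sq_le_sq_mul_sq _ _ _).trans
    (mul_le_mul_of_nonneg_right hcsq (Finset.sum_nonneg fun i _ => sq_nonneg _))

/- For `A s = Gᴴ * G`, the vectors `Gᴴ *ᵥ w` with `w ⬝ᵥ w ≤ 1` form the ellipsoid of all `u` with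
`vecMulVec u u ≤ A s`; the matrix `V` is built from Auerbach vectors of the union of these. -/
theorem exists_dominating_of_exists_posDef [Finite σ] {A : σ → Matrix ι ι ℝ}
    {B : τ → Matrix ι ι ℝ} (hA : ∀ s, (A s).PosSemidef) (hA₀ : ∃ s, (A s).PosDef)
    (hB : ∀ t, (B t).PosSemidef) (hAB : ∀ s t, (A s * B t).trace ≤ 1) :
    ∃ V : Matrix ι ι ℝ, (∀ s, A s ≤ V) ∧ ∀ t, (V * B t).trace ≤ (Fintype.card ι : ℝ) ^ 2 := by
  classical
  choose G hG using fun s => exists_eq_conjTranspose_mul_self (hA s)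
  set Ω : Set (ι → ℝ) := ⋃ s, (fun w => (G s)ᴴ *ᵥ w) '' {w | w ⬝ᵥ w ≤ 1}
  have hcompact : IsCompact Ω := isCompact_iUnion fun s =>
    isCompact_setOf_dotProduct_self_le_one.image (by fun_prop)
  have hmem (s) {w : ι → ℝ} (hw : w ⬝ᵥ w ≤ 1) : (G s)ᴴ *ᵥ w ∈ Ω :=
    Set.mem_iUnion.mpr ⟨s, w, hw, rfl⟩
  obtain ⟨s₀, hs₀⟩ := hA₀
  have hrow (i) : G s₀ i ∈ Ω := by
    have hi : (G s₀)ᴴ *ᵥ Pi.single i 1 = G s₀ i := by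
      rw [mulVec_single_one]
      ext j
      simp
    exact hi ▸ hmem s₀ (by simp)
  have hdet : (G s₀).det ≠ 0 := fun h => by simpa [hG, h] using hs₀.det_pos
  obtain ⟨U, hU, hspan⟩ := exists_forall_mem_eq_sum_smul hcompact hrow hdet
  refine ⟨(Fintype.card ι : ℝ) • (Uᴴ * U), fun s => ?_, fun t => ?_⟩
  · have hV : ((Fintype.card ι : ℝ) • (Uᴴ * U)).PosSemidef :=
      (posSemidef_conjTranspose_mul_self U).smul (Nat.cast_nonneg _)
    refine PosSemidef.of_dotProduct_mulVec_nonneg (hV.1.sub (hA s).1) fun v => ?_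
    rw [star_trivial, sub_mulVec, dotProduct_sub, sub_nonneg, hG s,
      dotProduct_conjTranspose_mul_self_mulVec]
    refine dotProduct_self_le_of_forall fun w hw => ?_
    obtain ⟨c, hc, hu⟩ := hspan _ (hmem s hw)
    have hwv : w ⬝ᵥ G s *ᵥ v = ((G s)ᴴ *ᵥ w) ⬝ᵥ v := by
      rw [dotProduct_mulVec, mulVec_conjTranspose, star_trivial, star_trivial]
    exact hwv ▸ sq_dotProduct_le_of_eq_sum_smul hc hu v
  · have hΩB : ∀ u ∈ Ω, u ⬝ᵥ B t *ᵥ u ≤ 1 := by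
      intro u hu
      obtain ⟨s, w, hw, rfl⟩ := Set.mem_iUnion.mp hu
      exact dotProduct_mulVec_conjTranspose_mulVec_le (hB t) (hG s ▸ hAB s t) hw
    rw [smul_mul, trace_smul, smul_eq_mul, trace_conjTranspose_mul_self_mul, sq]
    refine mul_le_mul_of_nonneg_left ?_ (Nat.cast_nonneg _)
    simpa using Finset.sum_le_card_nsmul Finset.univ (fun i => U i ⬝ᵥ B t *ᵥ U i) 1 fun i _ =>
      hΩB _ (hU i)

theorem exists_posDef_dominating [Finite σ] [Finite τ] {A : σ → Matrix ι ι ℝ}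
    {B : τ → Matrix ι ι ℝ} (hA : ∀ s, (A s).PosSemidef) (hB : ∀ t, (B t).PosSemidef)
    (hAB : ∀ s t, (A s * B t).trace ≤ 1) :
    ∃ V : Matrix ι ι ℝ, V.PosDef ∧ (∀ s, A s ≤ V) ∧
      ∀ t, (V * B t).trace ≤ (Fintype.card ι : ℝ) ^ 2 := by
  classical
  obtain ⟨δ, hδ, hδB⟩ : ∃ δ : ℝ, 0 < δ ∧ ∀ t, δ * (B t).trace ≤ 1 := by
    obtain ⟨b, hb⟩ := Finite.bddAbove_range fun t => (B t).trace
    refine ⟨(max b 1)⁻¹, by positivity, fun t => ?_⟩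
    rw [inv_mul_le_one₀ (by positivity)]
    exact (hb ⟨t, rfl⟩).trans (le_max_left b 1)
  have hδpd : (δ • (1 : Matrix ι ι ℝ)).PosDef := PosDef.one.smul hδ
  obtain ⟨V, hV, hVB⟩ := exists_dominating_of_exists_posDef
    (A := fun s : Option σ => s.elim (δ • 1) A) (Option.forall.mpr ⟨hδpd.posSemidef, hA⟩)
    ⟨none, hδpd⟩ hB (Option.forall.mpr ⟨fun t => by simpa using hδB t, hAB⟩)
  exact ⟨V, by simpa using hδpd.add_posSemidef (hV none), fun s => hV (some s), hVB⟩

theorem exists_whitening {W : Matrix ι ι ℝ} [DecidableEq ι] (hW : W.PosDef) :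
    ∃ G H : Matrix ι ι ℝ, Gᴴ * G = W ∧ H * G = 1 ∧ Hᴴ * W * H = 1 := by
  obtain ⟨G, rfl⟩ := exists_eq_conjTranspose_mul_self hW.posSemidef
  have hdet : IsUnit G.det := isUnit_iff_ne_zero.mpr fun h => by simpa [h] using hW.det_pos
  refine ⟨G, G⁻¹, rfl, nonsing_inv_mul G hdet, ?_⟩
  rw [← Matrix.mul_assoc, ← conjTranspose_mul, mul_nonsing_inv G hdet, conjTranspose_one,
    Matrix.one_mul, mul_nonsing_inv G hdet]

theorem trace_expect_mul [Fintype σ] (A : σ → Matrix ι ι ℝ) (B : Matrix ι ι ℝ) :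
    ((𝔼 s, A s) * B).trace = 𝔼 s, (A s * B).trace := by
  classical
  rw [Finset.expect_mul]
  exact map_expect (traceLinearMap ι ℚ≥0 ℝ) _ _

theorem exists_posDef_expect_le [Fintype σ] [Nonempty σ] [Finite τ] [Nonempty ι]
    {A : σ → Matrix ι ι ℝ} {B : τ → Matrix ι ι ℝ} (hA : ∀ s, (A s).PosSemidef)
    (hB : ∀ t, (B t).PosSemidef) (hAB : ∀ s t, (A s * B t).trace ≤ 1) :
    ∃ W : Matrix ι ι ℝ, W.PosDef ∧ (∀ s, A s ≤ (Fintype.card ι : ℝ) ^ 2 • W) ∧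
      𝔼 s, A s ≤ W ∧ ∀ t, (W * B t).trace ≤ 2 := by
  obtain ⟨V, hV, hAV, hVB⟩ := exists_posDef_dominating hA hB hAB
  set a : ℝ := (Fintype.card ι : ℝ) ^ 2
  have ha : 0 < a := by positivity
  set E := 𝔼 s, A s
  have hE : 0 ≤ E := Finset.expect_nonneg fun s _ => (hA s).nonneg
  set W := E + a⁻¹ • V
  have hEW : E ≤ W := le_add_of_nonneg_right (hV.posSemidef.smul (inv_nonneg.mpr ha.le)).nonneg
  have hAW (s) : A s ≤ a • W := by
    have haW : a • W = a • E + V := by rw [smul_add, smul_inv_smul₀ ha.ne']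
    exact (hAV s).trans (haW ▸ le_add_of_nonneg_left (hE.posSemidef.smul ha.le).nonneg)
  have hWB (t) : (W * B t).trace ≤ 2 := by
    have hEB : (E * B t).trace ≤ 1 := by
      rw [trace_expect_mul]
      exact Finset.expect_le Finset.univ_nonempty fun s _ => hAB s t
    have hVB' : a⁻¹ * (V * B t).trace ≤ 1 := (inv_mul_le_one₀ ha).mpr (hVB t)
    rw [Matrix.add_mul, trace_add, smul_mul, trace_smul, smul_eq_mul]
    linarith
  exact ⟨W, (hV.smul (inv_pos.mpr ha)).posSemidef_add hE.posSemidef, hAW, hEW, hWB⟩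

theorem exists_rescaled_factorization [Fintype σ] [Nonempty σ] [Finite τ] [Nonempty ι]
    [DecidableEq ι] {A : σ → Matrix ι ι ℝ} {B : τ → Matrix ι ι ℝ} (hA : ∀ s, (A s).PosSemidef)
    (hB : ∀ t, (B t).PosSemidef) (hAB : ∀ s t, (A s * B t).trace ≤ 1) :
    ∃ (A' : σ → Matrix ι ι ℝ) (B' : τ → Matrix ι ι ℝ),
      (∀ s, (A' s).PosSemidef) ∧ (∀ t, (B' t).PosSemidef) ∧
      (∀ s t, (A' s * B' t).trace = (A s * B t).trace) ∧
      (∀ s, A' s ≤ (Fintype.card ι : ℝ) ^ 2 • 1) ∧ 𝔼 s, A' s ≤ 1 ∧ ∀ t, (B' t).trace ≤ 2 := by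
  obtain ⟨W, hW, hAW, hEW, hWB⟩ := exists_posDef_expect_le hA hB hAB
  obtain ⟨G, H, hGW, hHG, hHW⟩ := exists_whitening hW
  have hconj {X Y : Matrix ι ι ℝ} (hXY : X ≤ Y) : Hᴴ * X * H ≤ Hᴴ * Y * H :=
    star_left_conjugate_le_conjugate hXY H
  refine ⟨fun s => Hᴴ * A s * H, fun t => G * B t * Gᴴ,
    fun s => (hA s).conjTranspose_mul_mul_same H, fun t => (hB t).mul_mul_conjTranspose_same G,
    fun s t => ?_, fun s => ?_, ?_, fun t => ?_⟩
  · calc (Hᴴ * A s * H * (G * B t * Gᴴ)).trace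
        = (Hᴴ * (A s * (H * G) * B t * Gᴴ)).trace := by simp only [Matrix.mul_assoc]
      _ = (A s * B t * (H * G)ᴴ).trace := by
        rw [hHG, Matrix.mul_one, trace_mul_comm, Matrix.mul_assoc, ← conjTranspose_mul, hHG]
      _ = (A s * B t).trace := by rw [hHG, conjTranspose_one, Matrix.mul_one]
  · simpa only [Matrix.mul_smul, smul_mul, hHW] using hconj (hAW s)
  · have hEH : 𝔼 s, Hᴴ * A s * H = Hᴴ * (𝔼 s, A s) * H := by
      rw [Finset.mul_expect, Finset.expect_mul]
    exact hEH.trans_le ((hconj hEW).trans_eq hHW)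
  · rw [trace_mul_comm, ← Matrix.mul_assoc, hGW]
    exact hWB t

end Matrices

/-! ### The test operator -/

section TestOperator

open Matrix
open scoped MatrixOrder

variable {ι : Type*} {n m d t : ℕ} {D : Cube m → ℝ} {A : SubsetOfCard n m → Matrix ι ι ℝ} {a θ : ℝ}

/-- The operator `Λ(x) = E_S D(x_S) A_S`. If `N S x = Tr (A S * B x)`, then
`L_D(N) = E_x Tr (Λ(x) B_x)`, and the pseudo-density `D` is tested against `Λ` instead of `N`. -/
noncomputable def testOperator (D : Cube m → ℝ) (A : SubsetOfCard n m → Matrix ι ι ℝ) (x : Cube n) :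
    Matrix ι ι ℝ :=
  𝔼 S, D (cubeRestrict S x) • A S

theorem testOperator_apply (D : Cube m → ℝ) (A : SubsetOfCard n m → Matrix ι ι ℝ) (x : Cube n)
    (i j : ι) : testOperator D A x i j = 𝔼 S, D (cubeRestrict S x) * A S i j :=
  map_expect (entryLinearMap ℚ≥0 ℝ i j) _ _

theorem testOperator_mem_lowDegree (D : Cube m → ℝ) (A : SubsetOfCard n m → Matrix ι ι ℝ)
    (i j : ι) : (fun x => testOperator D A x i j) ∈ lowDegree n m := by
  have hsum : (fun x => testOperator D A x i j) = (Fintype.card (SubsetOfCard n m) : ℝ)⁻¹ •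
      ∑ S, A S i j • fun x => D (cubeRestrict S x) := by
    funext x
    simp only [testOperator_apply, Fintype.expect_eq_sum_div_card, div_eq_inv_mul, Pi.smul_apply,
      Finset.sum_apply, smul_eq_mul, mul_comm (A _ i j)]
  rw [hsum]
  exact Submodule.smul_mem _ _ (Submodule.sum_mem _ fun S _ =>
    Submodule.smul_mem _ _ (comp_embedding_mem_lowDegree _ D))

theorem testOperator_le_norm_smul_one [Finite ι] [DecidableEq ι] (hA : ∀ S, (A S).PosSemidef)
    (hA₁ : 𝔼 S, A S ≤ 1) (x : Cube n) : testOperator D A x ≤ ‖D‖ • 1 := by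
  cases nonempty_fintype ι
  calc testOperator D A x ≤ 𝔼 S, ‖D‖ • A S := by
        refine Finset.expect_le_expect fun S _ => smul_le_smul_of_nonneg_right ?_ (hA S).nonneg
        exact (le_abs_self _).trans (norm_le_pi_norm D _)
    _ = ‖D‖ • 𝔼 S, A S := (Finset.smul_expect _ _ _).symm
    _ ≤ ‖D‖ • 1 := smul_le_smul_of_nonneg_left hA₁ (norm_nonneg D)

variable [Fintype ι]

theorem trace_conjTranspose_mul_conjTranspose_mul_self_mul (G Q : Matrix ι ι ℝ) :
    (Qᴴ * (Gᴴ * G) * Q).trace = ∑ i, ∑ j, (G * Q) i j ^ 2 := by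
  rw [← trace_conjTranspose_mul_self_eq_sum, conjTranspose_mul]
  simp only [Matrix.mul_assoc]

theorem trace_conjTranspose_mul_mul_self (P X : Matrix ι ι ℝ) :
    (Pᴴ * X * P).trace = (X * (P * Pᴴ)).trace := by
  rw [Matrix.mul_assoc, trace_mul_comm, Matrix.mul_assoc]

theorem trace_conjTranspose_mul_mul_le [DecidableEq ι] {A : Matrix ι ι ℝ} (hA : A ≤ a • 1)
    (Q : Matrix ι ι ℝ) : (Qᴴ * A * Q).trace ≤ a * ∑ i, ∑ j, Q i j ^ 2 := by
  calc (Qᴴ * A * Q).trace = (A * (Q * Qᴴ)).trace := trace_conjTranspose_mul_mul_self Q A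
    _ ≤ (a • 1 * (Q * Qᴴ)).trace :=
        trace_mul_le_trace_mul hA (posSemidef_self_mul_conjTranspose Q)
    _ = a * ∑ i, ∑ j, Q i j ^ 2 := by
        rw [smul_mul, Matrix.one_mul, trace_smul, trace_mul_comm,
          trace_conjTranspose_mul_self_eq_sum, smul_eq_mul]

theorem highPart_matrix_mul_apply (s : ℕ) (S : Finset (Fin n)) (G : Matrix ι ι ℝ)
    (P : Cube n → Matrix ι ι ℝ) (i j : ι) (x : Cube n) :
    highPart s S (fun y => (G * P y) i j) x
      = (G * of fun k l => highPart s S (fun y => P y k l) x) i j := by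
  have hsum : (fun y => (G * P y) i j) = ∑ k, G i k • fun y => P y k j := by
    funext y
    simp only [mul_apply, Finset.sum_apply, Pi.smul_apply, smul_eq_mul]
  rw [hsum]
  simp only [map_sum, map_smul, Finset.sum_apply, Pi.smul_apply, smul_eq_mul, mul_apply, of_apply]

theorem sum_expect_highPart_matrix_mul_sq_le [DecidableEq ι] {G : Matrix ι ι ℝ}
    (hG : Gᴴ * G ≤ a • 1) (s : ℕ) (S : Finset (Fin n)) (P : Cube n → Matrix ι ι ℝ) :
    ∑ i, ∑ j, 𝔼 x, highPart s S (fun y => (G * P y) i j) x ^ 2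
      ≤ a * ∑ i, ∑ j, 𝔼 x, highPart s S (fun y => P y i j) x ^ 2 := by
  simp only [← Finset.expect_sum_comm, Finset.mul_expect]
  refine Finset.expect_le_expect fun x _ => ?_
  simp only [highPart_matrix_mul_apply, ← trace_conjTranspose_mul_conjTranspose_mul_self_mul]
  exact trace_conjTranspose_mul_mul_le hG _

theorem IsPseudoDensity.neg_le_expect_comp_mul_trace [DecidableEq ι] (hD : IsPseudoDensity d D)
    (e : Fin m ↪ Fin n) {A : Matrix ι ι ℝ} (hA : A.PosSemidef) (hAa : A ≤ a • 1)
    (P : Cube n → Matrix ι ι ℝ) (hθ : 0 < θ) :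
    -(‖D‖ * (θ * 𝔼 x, ((P x)ᴴ * A * P x).trace + (1 / θ + 1) *
        (a * ∑ i, ∑ j, 𝔼 x, highPart (d / 2 + 1) (Finset.univ.map e) (fun y => P y i j) x ^ 2)))
      ≤ 𝔼 x, D (x ∘ e) * ((P x)ᴴ * A * P x).trace := by
  obtain ⟨G, rfl⟩ := exists_eq_conjTranspose_mul_self hA
  set H : (Cube n → ℝ) →ₗ[ℝ] (Cube n → ℝ) := highPart (d / 2 + 1) (Finset.univ.map e)
  calc -(‖D‖ * (θ * 𝔼 x, ((P x)ᴴ * (Gᴴ * G) * P x).trace + (1 / θ + 1) *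
          (a * ∑ i, ∑ j, 𝔼 x, H (fun y => P y i j) x ^ 2)))
      ≤ -(‖D‖ * (θ * 𝔼 x, ((P x)ᴴ * (Gᴴ * G) * P x).trace + (1 / θ + 1) *
          ∑ i, ∑ j, 𝔼 x, H (fun y => (G * P y) i j) x ^ 2)) := by
        gcongr
        exact sum_expect_highPart_matrix_mul_sq_le hAa _ _ _
    _ = ∑ i, ∑ j, -(‖D‖ * (θ * 𝔼 x, (G * P x) i j ^ 2
          + (1 / θ + 1) * 𝔼 x, H (fun y => (G * P y) i j) x ^ 2)) := by
        simp only [trace_conjTranspose_mul_conjTranspose_mul_self_mul, Finset.expect_sum_comm,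
          Finset.sum_neg_distrib, ← Finset.mul_sum, Finset.sum_add_distrib]
    _ ≤ ∑ i, ∑ j, 𝔼 x, D (x ∘ e) * (G * P x) i j ^ 2 :=
        Finset.sum_le_sum fun i _ => Finset.sum_le_sum fun j _ =>
          hD.neg_le_expect_comp_mul_sq e _ hθ
    _ = 𝔼 x, D (x ∘ e) * ((P x)ᴴ * (Gᴴ * G) * P x).trace := by
        simp only [trace_conjTranspose_mul_conjTranspose_mul_self_mul, Finset.mul_sum,
          Finset.expect_sum_comm]

theorem trace_testOperator_mul (D : Cube m → ℝ) (A : SubsetOfCard n m → Matrix ι ι ℝ)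
    (x : Cube n) (B : Matrix ι ι ℝ) :
    (testOperator D A x * B).trace = 𝔼 S, D (cubeRestrict S x) * (A S * B).trace := by
  rw [testOperator, trace_expect_mul]
  simp only [smul_mul, trace_smul, smul_eq_mul]

theorem expect_expect_trace_le [DecidableEq ι] (hA₁ : 𝔼 S, A S ≤ 1)
    (P : Cube n → Matrix ι ι ℝ) :
    𝔼 S, 𝔼 x, ((P x)ᴴ * A S * P x).trace ≤ 𝔼 x, ((P x)ᴴ * P x).trace := by
  rw [Finset.expect_comm]
  refine Finset.expect_le_expect fun x _ => ?_
  simp only [trace_conjTranspose_mul_mul_self, ← trace_expect_mul]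
  refine (trace_mul_le_trace_mul hA₁ (posSemidef_self_mul_conjTranspose (P x))).trans_eq ?_
  rw [Matrix.one_mul, trace_mul_comm]

theorem expect_sum_expect_highPart_sq_le (hmn : m ≤ n) (s : ℕ) {P : Cube n → Matrix ι ι ℝ}
    (hP : ∀ i j, (fun x => P x i j) ∈ lowDegree n t) :
    𝔼 S : SubsetOfCard n m, ∑ i, ∑ j, 𝔼 x, highPart s S.1 (fun y => P y i j) x ^ 2
      ≤ (t * (m / n) : ℝ) ^ s * 𝔼 x, ((P x)ᴴ * P x).trace := by
  simp only [trace_conjTranspose_mul_self_eq_sum, Finset.expect_sum_comm, Finset.mul_sum]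
  exact Finset.sum_le_sum fun i _ => Finset.sum_le_sum fun j _ =>
    expect_expect_highPart_sq_le hmn s (hP i j)

theorem IsPseudoDensity.neg_le_expect_trace_testOperator [DecidableEq ι] (hmn : m ≤ n)
    (hD : IsPseudoDensity d D) (hA : ∀ S, (A S).PosSemidef) (ha : 0 ≤ a) (hAa : ∀ S, A S ≤ a • 1)
    (hA₁ : 𝔼 S, A S ≤ 1) {P : Cube n → Matrix ι ι ℝ}
    (hP : ∀ i j, (fun x => P x i j) ∈ lowDegree n t) (hθ : 0 < θ) :
    -(‖D‖ * (θ + (1 / θ + 1) * (a * (t * (m / n) : ℝ) ^ (d / 2 + 1)))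
        * 𝔼 x, ((P x)ᴴ * P x).trace)
      ≤ 𝔼 x, (testOperator D A x * (P x * (P x)ᴴ)).trace := by
  calc -(‖D‖ * (θ + (1 / θ + 1) * (a * (t * (m / n) : ℝ) ^ (d / 2 + 1)))
          * 𝔼 x, ((P x)ᴴ * P x).trace)
      = -(‖D‖ * (θ * 𝔼 x, ((P x)ᴴ * P x).trace + (1 / θ + 1) *
          (a * ((t * (m / n) : ℝ) ^ (d / 2 + 1) * 𝔼 x, ((P x)ᴴ * P x).trace)))) := by ring
    _ ≤ -(‖D‖ * (θ * 𝔼 S, 𝔼 x, ((P x)ᴴ * A S * P x).trace + (1 / θ + 1) *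
          (a * 𝔼 S : SubsetOfCard n m, ∑ i, ∑ j,
            𝔼 x, highPart (d / 2 + 1) S.1 (fun y => P y i j) x ^ 2))) := by
        gcongr
        · exact expect_expect_trace_le hA₁ P
        · exact expect_sum_expect_highPart_sq_le hmn _ hP
    _ = 𝔼 S : SubsetOfCard n m, -(‖D‖ * (θ * 𝔼 x, ((P x)ᴴ * A S * P x).trace + (1 / θ + 1) *
          (a * ∑ i, ∑ j, 𝔼 x, highPart (d / 2 + 1) S.1 (fun y => P y i j) x ^ 2))) := by
        simp only [Finset.expect_neg_distrib, ← Finset.mul_expect, Finset.expect_add_distrib]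
    _ ≤ 𝔼 S, 𝔼 x, D (cubeRestrict S x) * ((P x)ᴴ * A S * P x).trace := by
        refine Finset.expect_le_expect fun S _ => ?_
        have htest := hD.neg_le_expect_comp_mul_trace (S.1.orderEmbOfFin S.2).toEmbedding (hA S)
          (hAa S) P hθ
        rwa [Finset.map_orderEmbOfFin_univ] at htest
    _ = 𝔼 x, (testOperator D A x * (P x * (P x)ᴴ)).trace := by
        rw [Finset.expect_comm]
        simp only [trace_testOperator_mul, trace_conjTranspose_mul_mul_self]

end TestOperator

/-! ### Spectral weights and power means -/

section PowerMeans

open Matrix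

variable {ι σ : Type*} [Fintype ι] [Fintype σ]

theorem exists_spectral_weights [DecidableEq ι] {M B : Matrix ι ι ℝ} (hM : M.PosSemidef)
    (hB : B.PosSemidef) :
    ∃ μ w : ι → ℝ, (∀ i, 0 ≤ μ i) ∧ (∀ i, 0 ≤ w i) ∧ (∀ i, w i ≤ B.trace) ∧
      ∀ k : ℕ, (M ^ k).trace = ∑ i, μ i ^ k ∧ (M ^ k * B).trace = ∑ i, μ i ^ k * w i := by
  set U : Matrix ι ι ℝ := hM.1.eigenvectorUnitary.1
  set μ : ι → ℝ := hM.1.eigenvalues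
  have hU : U * Uᴴ = 1 := Unitary.coe_mul_star_self hM.1.eigenvectorUnitary
  have hU' : Uᴴ * U = 1 := Unitary.coe_star_mul_self hM.1.eigenvectorUnitary
  have hpow (k : ℕ) : M ^ k = U * diagonal (fun i => μ i ^ k) * Uᴴ := by
    conv_lhs => rw [hM.1.spectral_theorem, ← map_pow, diagonal_pow]
    rfl
  have hw : (Uᴴ * B * U).PosSemidef := hB.conjTranspose_mul_mul_same U
  have htrace : (Uᴴ * B * U).trace = B.trace := by
    rw [trace_mul_comm, ← Matrix.mul_assoc, hU, Matrix.one_mul]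
  refine ⟨μ, (Uᴴ * B * U).diag, hM.eigenvalues_nonneg, fun i => hw.diag_nonneg,
    fun i => ?_, fun k => ⟨?_, ?_⟩⟩
  · rw [← htrace]
    exact Finset.single_le_sum (f := (Uᴴ * B * U).diag) (fun j _ => hw.diag_nonneg)
      (Finset.mem_univ i)
  · rw [hpow, trace_mul_comm, ← Matrix.mul_assoc, hU', Matrix.one_mul, trace_diagonal]
  · calc (M ^ k * B).trace = (diagonal (fun i => μ i ^ k) * (Uᴴ * B * U)).trace := by
          rw [hpow, Matrix.mul_assoc, Matrix.mul_assoc, trace_mul_comm]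
          simp only [Matrix.mul_assoc]
      _ = ∑ i, μ i ^ k * (Uᴴ * B * U).diag i := by simp only [trace, diag_apply, diagonal_mul]

theorem succ_mul_pow_mul_le {a b : ℝ} (ha : 0 ≤ a) (hb : 0 ≤ b) (q : ℕ) :
    ((q : ℝ) + 1) * (a ^ q * b) ≤ q * a ^ (q + 1) + b ^ (q + 1) := by
  induction q with
  | zero => simp
  | succ q ih =>
    push_cast
    calc ((q : ℝ) + 1 + 1) * (a ^ (q + 1) * b)
        = (q + 1) * a ^ (q + 2) - q * a ^ (q + 1) * b + (q + 1) * (a ^ q * b) * b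
            - (q + 1) * a ^ q * (a - b) ^ 2 := by ring
      _ ≤ (q + 1) * a ^ (q + 2) - q * a ^ (q + 1) * b + (q * a ^ (q + 1) + b ^ (q + 1)) * b
            - 0 := by
        gcongr
        positivity
      _ = (q + 1) * a ^ (q + 1 + 1) + b ^ (q + 1 + 1) := by ring

theorem sum_pow_le_card_mul_pow {μ : σ → ℝ} (hμ : ∀ i, 0 ≤ μ i) {q : ℕ} {ρ : ℝ} (hρ : 0 < ρ)
    (hmom : ∑ i, μ i ^ (q + 1) ≤ ρ * ∑ i, μ i ^ q) :
    ∑ i, μ i ^ q ≤ Fintype.card σ * ρ ^ q := by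
  have hamgm := Finset.sum_le_sum fun i (_ : i ∈ Finset.univ) =>
    succ_mul_pow_mul_le (hμ i) hρ.le q
  rw [← Finset.mul_sum, ← Finset.sum_mul, Finset.sum_add_distrib, ← Finset.mul_sum,
    Finset.sum_const, Finset.card_univ, nsmul_eq_mul, pow_succ ρ] at hamgm
  refine le_of_mul_le_mul_right ?_ hρ
  linarith [mul_le_mul_of_nonneg_left hmom q.cast_nonneg]

theorem sum_mul_le_of_sum_pow_succ_le {μ w : σ → ℝ} (hμ : ∀ i, 0 ≤ μ i) (hw : ∀ i, 0 ≤ w i)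
    {b : ℝ} (hwb : ∀ i, w i ≤ b) (hw₀ : 0 < ∑ i, w i) {q : ℕ} (hq : q ≠ 0) {ρ c : ℝ}
    (hρ : 0 < ρ) (hc : 0 ≤ c) (hmom : ∑ i, μ i ^ (q + 1) ≤ ρ * ∑ i, μ i ^ q)
    (hcq : b * Fintype.card σ ≤ c ^ q * ∑ i, w i) :
    ∑ i, μ i * w i ≤ c * ρ * ∑ i, w i := by
  obtain ⟨i₀, -, -⟩ := Finset.exists_ne_zero_of_sum_ne_zero hw₀.ne'
  have hb : 0 ≤ b := (hw i₀).trans (hwb i₀)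
  set W := ∑ i, w i
  have hmean : (∑ i, w i / W * μ i) ^ q ≤ (c * ρ) ^ q := by
    calc (∑ i, w i / W * μ i) ^ q ≤ ∑ i, w i / W * μ i ^ q :=
          Real.pow_arith_mean_le_arith_mean_pow Finset.univ _ μ
            (fun i _ => div_nonneg (hw i) hw₀.le)
            ((Finset.sum_div _ _ _).symm.trans (div_self hw₀.ne')) (fun i _ => hμ i) q
      _ ≤ ∑ i, b / W * μ i ^ q := by
          gcongr with i
          · exact pow_nonneg (hμ i) q
          · exact hwb i
      _ = b / W * ∑ i, μ i ^ q := by rw [Finset.mul_sum]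
      _ ≤ b / W * (Fintype.card σ * ρ ^ q) := by
          gcongr
          exact sum_pow_le_card_mul_pow hμ hρ hmom
      _ = b * Fintype.card σ / W * ρ ^ q := by ring
      _ ≤ c ^ q * ρ ^ q := by
          gcongr
          exact (div_le_iff₀ hw₀).mpr hcq
      _ = (c * ρ) ^ q := (mul_pow _ _ _).symm
  have hle := le_of_pow_le_pow_left₀ hq (by positivity) hmean
  rw [← div_le_iff₀ hw₀, Finset.sum_div]
  simpa only [mul_comm, mul_div_assoc] using hle

theorem expect_trace_mul_le [DecidableEq ι] {M B : σ → Matrix ι ι ℝ} (hM : ∀ x, (M x).PosSemidef)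
    (hB : ∀ x, (B x).PosSemidef) {b : ℝ} (hBb : ∀ x, (B x).trace ≤ b)
    (hB₀ : 0 < 𝔼 x, (B x).trace) {q : ℕ} (hq : q ≠ 0) {ρ c : ℝ} (hρ : 0 < ρ) (hc : 0 ≤ c)
    (hmom : 𝔼 x, (M x ^ (q + 1)).trace ≤ ρ * 𝔼 x, (M x ^ q).trace)
    (hcq : b * Fintype.card ι ≤ c ^ q * 𝔼 x, (B x).trace) :
    𝔼 x, (M x * B x).trace ≤ c * ρ * 𝔼 x, (B x).trace := by
  have hcard : (0 : ℝ) < Fintype.card σ := by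
    obtain ⟨x, -, -⟩ := Finset.exists_ne_zero_of_expect_ne_zero hB₀.ne'
    exact_mod_cast Fintype.card_pos_iff.mpr ⟨x⟩
  choose μ w hμ hw hwB hspec using fun x => exists_spectral_weights (hM x) (hB x)
  have hpow (q : ℕ) : ∑ p : σ × ι, μ p.1 p.2 ^ q = Fintype.card σ * 𝔼 x, (M x ^ q).trace := by
    simp only [Fintype.card_mul_expect, Fintype.sum_prod_type, hspec]
  have hpow_mul (q : ℕ) : ∑ p : σ × ι, μ p.1 p.2 ^ q * w p.1 p.2
      = Fintype.card σ * 𝔼 x, (M x ^ q * B x).trace := by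
    simp only [Fintype.card_mul_expect, Fintype.sum_prod_type, hspec]
  have hsum : ∑ p : σ × ι, w p.1 p.2 = Fintype.card σ * 𝔼 x, (B x).trace := by
    simpa only [pow_zero, one_mul] using hpow_mul 0
  have hmean := sum_mul_le_of_sum_pow_succ_le (μ := fun p : σ × ι => μ p.1 p.2)
    (w := fun p => w p.1 p.2) (fun p => hμ _ _) (fun p => hw _ _)
    (fun p => (hwB _ _).trans (hBb _)) (hsum ▸ mul_pos hcard hB₀) hq hρ hc
    (by rw [hpow, hpow, mul_left_comm]; gcongr)
    (by rw [hsum, Fintype.card_prod, Nat.cast_mul, mul_left_comm, mul_left_comm (c ^ q)]; gcongr)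
  refine le_of_mul_le_mul_left ?_ hcard
  calc Fintype.card σ * 𝔼 x, (M x * B x).trace = ∑ p : σ × ι, μ p.1 p.2 * w p.1 p.2 := by
        simpa only [pow_one] using (hpow_mul 1).symm
    _ ≤ c * ρ * ∑ p : σ × ι, w p.1 p.2 := hmean
    _ = Fintype.card σ * (c * ρ * 𝔼 x, (B x).trace) := by rw [hsum, mul_left_comm]

end PowerMeans

/-! ### The lower bound -/

section LowerBound

open Matrix
open scoped MatrixOrder

variable {ι : Type*} [DecidableEq ι] {n m d : ℕ} {D : Cube m → ℝ}
  {A : SubsetOfCard n m → Matrix ι ι ℝ} {a : ℝ}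

/-- The operator `M(x) = ‖D‖ - Λ(x)`, which is positive semidefinite when `E_S A_S ≤ 1`. Its high
powers concentrate on the directions in which `Λ` is most negative. -/
noncomputable def gapOperator (D : Cube m → ℝ) (A : SubsetOfCard n m → Matrix ι ι ℝ) (x : Cube n) :
    Matrix ι ι ℝ :=
  ‖D‖ • 1 - testOperator D A x

theorem gapOperator_posSemidef [Finite ι] (hA : ∀ S, (A S).PosSemidef) (hA₁ : 𝔼 S, A S ≤ 1)
    (x : Cube n) : (gapOperator D A x).PosSemidef :=
  le_iff.mp (testOperator_le_norm_smul_one hA hA₁ x)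

theorem gapOperator_mem_lowDegree (D : Cube m → ℝ) (A : SubsetOfCard n m → Matrix ι ι ℝ)
    (i j : ι) : (fun x => gapOperator D A x i j) ∈ lowDegree n m :=
  Submodule.sub_mem _ (const_mem_lowDegree m ((‖D‖ • (1 : Matrix ι ι ℝ)) i j))
    (testOperator_mem_lowDegree D A i j)

variable [Fintype ι]

theorem expect_trace_gapOperator_mul (D : Cube m → ℝ) (A : SubsetOfCard n m → Matrix ι ι ℝ)
    (X : Cube n → Matrix ι ι ℝ) :
    𝔼 x, (gapOperator D A x * X x).trace
      = ‖D‖ * 𝔼 x, (X x).trace - 𝔼 x, (testOperator D A x * X x).trace := by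
  simp only [gapOperator, Matrix.sub_mul, smul_mul, Matrix.one_mul, trace_sub, trace_smul,
    smul_eq_mul, Finset.expect_sub_distrib, Finset.mul_expect]

theorem IsPseudoDensity.expect_trace_gapOperator_pow_succ_le (hmn : m ≤ n)
    (hD : IsPseudoDensity d D) (hA : ∀ S, (A S).PosSemidef) (ha : 0 ≤ a) (hAa : ∀ S, A S ≤ a • 1)
    (hA₁ : 𝔼 S, A S ≤ 1) (k : ℕ) {θ : ℝ} (hθ : 0 < θ) :
    𝔼 x, (gapOperator D A x ^ (2 * k + 1)).trace
      ≤ ‖D‖ * (1 + (θ + (1 / θ + 1) * (a * ((k * m : ℕ) * (m / n) : ℝ) ^ (d / 2 + 1))))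
        * 𝔼 x, (gapOperator D A x ^ (2 * k)).trace := by
  have htest := hD.neg_le_expect_trace_testOperator hmn hA ha hAa hA₁
    (matrix_pow_mem_lowDegree (gapOperator_mem_lowDegree D A) k) hθ
  have hsymm (x : Cube n) : (gapOperator D A x ^ k)ᴴ = gapOperator D A x ^ k :=
    ((gapOperator_posSemidef hA hA₁ x).pow k).1
  simp only [hsymm, ← pow_add, ← two_mul] at htest
  calc 𝔼 x, (gapOperator D A x ^ (2 * k + 1)).trace
      = ‖D‖ * 𝔼 x, (gapOperator D A x ^ (2 * k)).trace
        - 𝔼 x, (testOperator D A x * gapOperator D A x ^ (2 * k)).trace := by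
        simp only [pow_succ' _ (2 * k), expect_trace_gapOperator_mul]
    _ ≤ _ := by linarith

theorem IsPseudoDensity.neg_le_expect_trace_testOperator_mul (hmn : m ≤ n)
    (hD : IsPseudoDensity d D) (hA : ∀ S, (A S).PosSemidef) (ha : 0 ≤ a) (hAa : ∀ S, A S ≤ a • 1)
    (hA₁ : 𝔼 S, A S ≤ 1) {B : Cube n → Matrix ι ι ℝ} (hB : ∀ x, (B x).PosSemidef)
    (hB₂ : ∀ x, (B x).trace ≤ 2) (hB₀ : 0 < 𝔼 x, (B x).trace) {η : ℝ} (hη : 0 < η) (hη₁ : η ≤ 1)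
    {k : ℕ} (hk : k ≠ 0) (hak : 144 * (a * ((k * m : ℕ) * (m / n) : ℝ) ^ (d / 2 + 1)) ≤ η ^ 2)
    (hkB : 2 * Fintype.card ι ≤ (1 + η / 8) ^ (2 * k) * 𝔼 x, (B x).trace) :
    -(η * ‖D‖) ≤ 𝔼 x, (testOperator D A x * B x).trace := by
  have hD₀ : 0 < ‖D‖ := one_pos.trans_le hD.one_le_norm
  have hM := gapOperator_posSemidef (D := D) hA hA₁
  set κ := a * ((k * m : ℕ) * (m / n) : ℝ) ^ (d / 2 + 1)
  have herror : η / 12 + (1 / (η / 12) + 1) * κ ≤ η / 4 := by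
    have hκ : 1 / (η / 12) * κ ≤ η / 12 := by
      rw [one_div_div, div_mul_eq_mul_div, div_le_iff₀ hη]
      linarith
    have hη₂ : η ^ 2 ≤ η := pow_le_of_le_one hη.le hη₁ two_ne_zero
    linarith
  have hmom : 𝔼 x, (gapOperator D A x ^ (2 * k + 1)).trace
      ≤ ‖D‖ * (1 + η / 4) * 𝔼 x, (gapOperator D A x ^ (2 * k)).trace :=
    (hD.expect_trace_gapOperator_pow_succ_le hmn hA ha hAa hA₁ k
      (by positivity : 0 < η / 12)).trans <| mul_le_mul_of_nonneg_right (by gcongr)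
        (Finset.expect_nonneg fun x _ => ((hM x).pow _).trace_nonneg)
  have hgap := expect_trace_mul_le hM hB hB₂ hB₀ (by positivity) (by positivity) (by positivity)
    hmom hkB
  rw [expect_trace_gapOperator_mul] at hgap
  have hβ₂ : 𝔼 x, (B x).trace ≤ 2 := Finset.expect_le Finset.univ_nonempty fun x _ => hB₂ x
  set β := 𝔼 x, (B x).trace
  have hexcess : (1 + η / 8) * (1 + η / 4) - 1 ≤ η / 2 := by nlinarith
  calc -(η * ‖D‖) = -(η / 2 * (‖D‖ * 2)) := by ring
    _ ≤ -(((1 + η / 8) * (1 + η / 4) - 1) * (‖D‖ * β)) := by gcongr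
    _ ≤ 𝔼 x, (testOperator D A x * B x).trace := by linarith

end LowerBound

/-! ### The choice of the degree -/

section DegreeChoice

open Real

theorem le_one_add_pow_of_log_le {K t : ℝ} (hK : 0 < K) (ht : 0 ≤ t) (ht₁ : t ≤ 1) {k : ℕ}
    (hlog : log K ≤ k * t) : K ≤ (1 + t) ^ (2 * k) := by
  have hhalf : t / 2 ≤ log (1 + t) := by
    refine le_trans ?_ (le_log_one_add_of_nonneg ht)
    rw [div_le_div_iff₀ two_pos (by positivity)]
    nlinarith
  rw [← log_le_log_iff hK (by positivity), log_pow]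
  have hk : (k : ℝ) * (t / 2) ≤ k * log (1 + t) := by gcongr
  push_cast
  linarith

theorem pow_half_add_one_mul_rpow_le {y z c : ℝ} (hy : 0 < y) (hy₁ : y ≤ 1) (hz : 0 ≤ z)
    (hc : 0 ≤ c) (hc₁ : c ≤ 1) (hyz : y * z ≤ c ^ 2) {d : ℕ} (hd : d ≠ 0) :
    y ^ (d / 2 + 1) * z ^ (d / 2 : ℝ) ≤ c := by
  have hexp : (d / 2 : ℝ) ≤ (d / 2 + 1 : ℕ) := by
    have hdiv : (d : ℝ) ≤ 2 * (d / 2 + 1 : ℕ) := mod_cast (by lia : d ≤ 2 * (d / 2 + 1))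
    linarith
  calc y ^ (d / 2 + 1) * z ^ (d / 2 : ℝ)
      ≤ y ^ (d / 2 : ℝ) * z ^ (d / 2 : ℝ) := by
        rw [← rpow_natCast]
        exact mul_le_mul_of_nonneg_right (rpow_le_rpow_of_exponent_ge hy hy₁ hexp) (by positivity)
    _ = (y * z) ^ (d / 2 : ℝ) := (mul_rpow hy.le hz).symm
    _ ≤ (c ^ 2) ^ (d / 2 : ℝ) := by gcongr
    _ = c ^ d := by
        rw [← rpow_natCast, ← rpow_mul hc, Nat.cast_ofNat, mul_div_cancel₀ _ two_ne_zero,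
          rpow_natCast]
    _ ≤ c := pow_le_of_le_one hc hc₁ hd

theorem one_le_of_sq_div_le_rpow {r ν z p : ℝ} (hr : 1 ≤ r) (hν : 0 < ν) (hν₁ : ν ≤ 1)
    (hz : 0 ≤ z) (hp : 0 < p) (h : r ^ 2 / ν ≤ z ^ p) : 1 ≤ z := by
  by_contra! hlt
  have hrν : 1 ≤ r ^ 2 / ν := (one_le_div hν).mpr (hν₁.trans (one_le_pow₀ hr))
  exact (hrν.trans h).not_gt (rpow_lt_one hz hlt hp)

theorem log_two_mul_div_le {r ν z x p : ℝ} (hr : 1 ≤ r) (hν : 0 < ν) (hz : 0 ≤ z) (hzx : z ≤ x)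
    (hx : 2 ≤ x) (hp : 1 / 2 ≤ p) (h : r ^ 2 / ν ≤ z ^ p) : log (2 * r / ν) ≤ 3 * p * log x := by
  have hK : 2 * r / ν ≤ 2 * x ^ p := by
    calc 2 * r / ν = 2 * (r / ν) := mul_div_assoc _ _ _
      _ ≤ 2 * (r ^ 2 / ν) := by gcongr; exact le_self_pow₀ hr two_ne_zero
      _ ≤ 2 * z ^ p := by gcongr
      _ ≤ 2 * x ^ p := by gcongr
  have hlog : log (2 * r / ν) ≤ log 2 + p * log x := by
    rw [← log_rpow (by linarith), ← log_mul two_ne_zero (by positivity)]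
    exact log_le_log (by positivity) hK
  have hlogx : log 2 ≤ log x := log_le_log two_pos hx
  nlinarith [log_pos one_lt_two]

theorem exists_nat_le_mul_and_mul_le {L X η : ℝ} (hL : 0 < L) (hLX : L ≤ 3 / 2 * X)
    (hX : 1 / 2 ≤ X) (hη : 0 < η) (hη₁ : η ≤ 1) :
    ∃ k : ℕ, k ≠ 0 ∧ L ≤ k * (η / 8) ∧ k * η ≤ 14 * X := by
  have hpos : 0 < 8 * L / η := by positivity
  refine ⟨⌈8 * L / η⌉₊, (Nat.ceil_pos.mpr hpos).ne', ?_, ?_⟩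
  · have hle := (div_le_iff₀ hη).mp (Nat.le_ceil (8 * L / η))
    linarith
  · have hlt := (Nat.ceil_lt_add_one hpos.le).le
    rw [div_add_one hη.ne', le_div_iff₀ hη] at hlt
    linarith

theorem div_mul_sq_mul_div_log_le {m d n : ℕ} (hm : 1 ≤ m) (hd : 1 ≤ d) {η : ℝ} (hη₁ : η ≤ 1)
    (hlog : 1 / 2 ≤ log n) : η / (10 ^ 6 * (d * m ^ 2)) * (n / log n) ≤ n := by
  have hdm : (1 : ℝ) ≤ d * m ^ 2 := mod_cast Nat.one_le_iff_ne_zero.mpr (by positivity)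
  calc η / (10 ^ 6 * (d * m ^ 2)) * ((n : ℝ) / log n)
      ≤ 1 / (10 ^ 6 * 1) * (n / (1 / 2)) := by gcongr
    _ ≤ (n : ℝ) := by linarith [n.cast_nonneg (α := ℝ)]

theorem mul_pow_half_add_one_le_sq {m d n k : ℕ} (hm : 1 ≤ m) (hd : 1 ≤ d) (hk : k ≠ 0)
    (hlog : 0 < log n) {η a : ℝ} (hη : 0 < η) (hη₁ : η ≤ 1) (hkη : k * η ≤ 14 * (d * log n))
    (hz : 1 ≤ η / (10 ^ 6 * (d * m ^ 2)) * (n / log n))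
    (ha : a ≤ (η / (10 ^ 6 * (d * m ^ 2)) * (n / log n)) ^ (d / 2 : ℝ) * η ^ 3) :
    144 * (a * ((k * m : ℕ) * (m / n) : ℝ) ^ (d / 2 + 1)) ≤ η ^ 2 := by
  have hn : n ≠ 0 := by
    rintro rfl
    simp at hlog
  set z : ℝ := η / (10 ^ 6 * (d * m ^ 2)) * (n / log n) with hz_def
  set y : ℝ := (k * m : ℕ) * (m / n) with hy_def
  have hy₀ : 0 < y := by positivity
  have hyz : y * z ≤ (1 / 144) ^ 2 := by
    have hyz_eq : y * z = k * η / (d * log n) / 10 ^ 6 := by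
      rw [hy_def, hz_def]
      push_cast
      field_simp
    rw [hyz_eq, div_le_iff₀ (by norm_num), div_le_iff₀ (by positivity)]
    nlinarith
  have hy₁ : y ≤ 1 := by linarith [le_mul_of_one_le_right hy₀.le hz]
  have hyzd := pow_half_add_one_mul_rpow_le hy₀ hy₁ (by positivity) (by norm_num) (by norm_num) hyz
    (Nat.one_le_iff_ne_zero.mp hd)
  calc 144 * (a * y ^ (d / 2 + 1))
      ≤ 144 * (z ^ (d / 2 : ℝ) * η ^ 3 * y ^ (d / 2 + 1)) := by gcongr
    _ = 144 * (y ^ (d / 2 + 1) * z ^ (d / 2 : ℝ)) * η ^ 3 := by ring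
    _ ≤ 144 * (1 / 144) * η ^ 3 := by gcongr
    _ = η ^ 3 := by ring
    _ ≤ η ^ 2 := pow_le_pow_of_le_one hη.le hη₁ (by norm_num)

theorem exists_degree_bound {n m d r : ℕ} (hm : 1 ≤ m) (hd : 1 ≤ d) (hn : 2 ≤ n) (hr : r ≠ 0)
    {η ν : ℝ} (hη : 0 < η) (hη₁ : η ≤ 1) (hν : 0 < ν) (hν₁ : ν ≤ 1)
    (h : (r : ℝ) ^ 2 / ν
      ≤ (η / (10 ^ 6 * (d * m ^ 2)) * (n / log n)) ^ (d / 2 : ℝ) * η ^ 3) :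
    ∃ k : ℕ, k ≠ 0 ∧ 144 * ((r : ℝ) ^ 2 * ((k * m : ℕ) * (m / n) : ℝ) ^ (d / 2 + 1)) ≤ η ^ 2 ∧
      2 * r ≤ (1 + η / 8) ^ (2 * k) * ν := by
  have hr₁ : (1 : ℝ) ≤ r := mod_cast Nat.one_le_iff_ne_zero.mpr hr
  have hd₁ : (1 : ℝ) ≤ d := mod_cast hd
  have hn₂ : (2 : ℝ) ≤ n := mod_cast hn
  have hlog : 1 / 2 ≤ log n := by linarith [log_two_gt_d9, log_le_log two_pos hn₂]
  have hzn := div_mul_sq_mul_div_log_le hm hd hη₁ hlog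
  set z : ℝ := η / (10 ^ 6 * (d * m ^ 2)) * (n / log n)
  have hz₀ : 0 ≤ z := by positivity
  have hrz : (r : ℝ) ^ 2 / ν ≤ z ^ (d / 2 : ℝ) :=
    h.trans (mul_le_of_le_one_right (by positivity) (pow_le_one₀ hη.le hη₁))
  have hz₁ : 1 ≤ z := one_le_of_sq_div_le_rpow hr₁ hν hν₁ hz₀ (by positivity) hrz
  have hK : 1 < 2 * r / ν := by rw [one_lt_div hν]; linarith
  have hlogK : log (2 * r / ν) ≤ 3 / 2 * (d * log n) := by
    linarith [log_two_mul_div_le hr₁ hν hz₀ hzn hn₂ (by linarith : (1 / 2 : ℝ) ≤ d / 2) hrz]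
  obtain ⟨k, hk, hKk, hkη⟩ := exists_nat_le_mul_and_mul_le (log_pos hK) hlogK (by nlinarith) hη hη₁
  have hrη := (le_div_self (sq_nonneg (r : ℝ)) hν hν₁).trans h
  refine ⟨k, hk, mul_pow_half_add_one_le_sq hm hd hk (by linarith) hη hη₁ hkη hz₁ hrη, ?_⟩
  rw [← div_le_iff₀ hν]
  exact le_one_add_pow_of_log_le (by positivity) (by positivity) (by linarith) hKk

end DegreeChoice

/-! ### The separating functional -/

section SeparatingFunctional

open Matrix Real
open scoped MatrixOrder

theorem entryAverage_pos {ι κ : Type} [Fintype ι] [Fintype κ] {N : ι → κ → ℝ}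
    (hN : ∀ i j, 0 ≤ N i j) (hN₀ : N ≠ 0) : 0 < entryAverage N := by
  obtain ⟨i, hi⟩ := Function.ne_iff.mp hN₀
  obtain ⟨j, hj⟩ := Function.ne_iff.mp hi
  refine Finset.expect_pos' (fun i _ => Finset.expect_nonneg fun j _ => hN i j)
    ⟨i, Finset.mem_univ i, ?_⟩
  exact Finset.expect_pos' (fun j _ => hN i j) ⟨j, Finset.mem_univ j, (hN i j).lt_of_ne' hj⟩

theorem apply_le_of_norm_le {ι κ : Type*} [Fintype ι] [Fintype κ] {N : ι → κ → ℝ} {c : ℝ}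
    (hN : ‖N‖ ≤ c) (i : ι) (j : κ) : N i j ≤ c :=
  (le_abs_self _).trans (((norm_le_pi_norm (N i) j).trans (norm_le_pi_norm N i)).trans hN)

theorem entryAverage_le_norm {ι κ : Type} [Fintype ι] [Nonempty ι] [Fintype κ] [Nonempty κ]
    (N : ι → κ → ℝ) : entryAverage N ≤ ‖N‖ :=
  Finset.expect_le Finset.univ_nonempty fun i _ =>
    Finset.expect_le Finset.univ_nonempty fun j _ => apply_le_of_norm_le le_rfl i j

theorem psdRank_ne_zero {ι κ : Type} [Finite ι] {N : ι → κ → ℝ} (hN : ∀ i j, 0 ≤ N i j)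
    (hN₀ : N ≠ 0) : psdRank N ≠ 0 := by
  cases nonempty_fintype ι
  intro hrank
  obtain ⟨A, B, -, -, hAB⟩ := hrank ▸ hasPsdFactorization_psdRank N hN
  exact hN₀ (funext₂ fun i j => by rw [hAB, trace_fin_zero, Pi.zero_apply, Pi.zero_apply])

variable {ι : Type*} {n m d : ℕ} {D : Cube m → ℝ} {N : SubsetOfCard n m → Cube n → ℝ}

theorem nonempty_subsetOfCard (hmn : m ≤ n) : Nonempty (SubsetOfCard n m) := by
  rw [← Fintype.card_pos_iff, Fintype.card_finset_len, Fintype.card_fin]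
  exact Nat.choose_pos hmn

theorem neg_norm_le_separatingFunctional (hmn : m ≤ n) (D : Cube m → ℝ) (hN : ∀ S x, 0 ≤ N S x)
    (hN₁ : ‖N‖ ≤ 1) : -‖D‖ ≤ separatingFunctional D N := by
  have := nonempty_subsetOfCard hmn
  refine Finset.le_expect Finset.univ_nonempty fun S _ =>
    Finset.le_expect Finset.univ_nonempty fun x _ => ?_
  have hD : -‖D‖ ≤ D (cubeRestrict S x) := (abs_le.mp (norm_le_pi_norm D _)).1
  calc -‖D‖ ≤ -‖D‖ * N S x := by
        nlinarith [apply_le_of_norm_le hN₁ S x, norm_nonneg D]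
    _ ≤ D (cubeRestrict S x) * N S x := mul_le_mul_of_nonneg_right hD (hN S x)

variable [Fintype ι] {A : SubsetOfCard n m → Matrix ι ι ℝ} {B : Cube n → Matrix ι ι ℝ}

theorem separatingFunctional_eq_expect_trace (D : Cube m → ℝ)
    (hN : ∀ S x, N S x = (A S * B x).trace) :
    separatingFunctional D N = 𝔼 x, (testOperator D A x * B x).trace := by
  simp only [separatingFunctional, trace_testOperator_mul, hN]
  exact Finset.expect_comm _ _ _

theorem entryAverage_le_expect_trace [DecidableEq ι] (hN : ∀ S x, N S x = (A S * B x).trace)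
    (hA₁ : 𝔼 S, A S ≤ 1) (hB : ∀ x, (B x).PosSemidef) :
    entryAverage N ≤ 𝔼 x, (B x).trace := by
  rw [entryAverage, Finset.expect_comm]
  refine Finset.expect_le_expect fun x _ => ?_
  simp only [hN, ← trace_expect_mul]
  simpa only [Matrix.one_mul] using trace_mul_le_trace_mul hA₁ (hB x)

theorem IsPseudoDensity.neg_mul_norm_le_separatingFunctional [Nonempty ι] (hmn : m ≤ n)
    (hD : IsPseudoDensity d D) (hA : ∀ S, (A S).PosSemidef)
    (hB : ∀ x, (B x).PosSemidef) (hN : ∀ S x, N S x = (A S * B x).trace) (hN₁ : ‖N‖ ≤ 1)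
    (hN₀ : 0 < entryAverage N) {η : ℝ} (hη : 0 < η) (hη₁ : η ≤ 1) {k : ℕ} (hk : k ≠ 0)
    (hkr : 144 * ((Fintype.card ι : ℝ) ^ 2 * ((k * m : ℕ) * (m / n) : ℝ) ^ (d / 2 + 1)) ≤ η ^ 2)
    (hkN : 2 * Fintype.card ι ≤ (1 + η / 8) ^ (2 * k) * entryAverage N) :
    -(η * ‖D‖) ≤ separatingFunctional D N := by
  classical
  have := nonempty_subsetOfCard hmn
  obtain ⟨A', B', hA', hB', htrace, hA'r, hA'₁, hB'₂⟩ := exists_rescaled_factorization hA hB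
    fun S x => (hN S x).symm.trans_le (apply_le_of_norm_le hN₁ S x)
  have hN' S x : N S x = (A' S * B' x).trace := (hN S x).trans (htrace S x).symm
  have hNB := entryAverage_le_expect_trace hN' hA'₁ hB'
  rw [separatingFunctional_eq_expect_trace D hN']
  exact hD.neg_le_expect_trace_testOperator_mul hmn hA' (by positivity) hA'r hA'₁ hB' hB'₂
    (hN₀.trans_le hNB) hη hη₁ hk hkr (hkN.trans (by gcongr))

end SeparatingFunctional

theorem mainTheorem6_general {m d n : ℕ} (hm : 1 ≤ m) (hd : 1 ≤ d) (hn : 2 ≤ n) (hmn : m ≤ n)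
    {ε : ℝ} (hε : 0 < ε) {D : Cube m → ℝ} (hD : IsPseudoDensity d D)
    {N : SubsetOfCard n m → Cube n → ℝ} (hN : ∀ S x, 0 ≤ N S x) (hN₁ : ‖N‖ ≤ 1)
    (hrank : (psdRank N : ℝ) ^ 2 / entryAverage N
      ≤ (1 / 10 ^ 6 * ε / (d * m ^ 2 * ‖D‖)) ^ (d / 2 : ℝ) * (ε / ‖D‖) ^ 3
        * (n / Real.log n) ^ (d / 2 : ℝ)) :
    -ε ≤ separatingFunctional D N := by
  rcases lt_or_ge ‖D‖ ε with hεD | hεD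
  · exact (neg_lt_neg hεD).le.trans (neg_norm_le_separatingFunctional hmn D hN hN₁)
  rcases eq_or_ne N 0 with rfl | hN₀
  · simp [separatingFunctional, hε.le]
  have := nonempty_subsetOfCard hmn
  have hD₀ : 0 < ‖D‖ := hε.trans_le hεD
  have hη : 0 < ε / ‖D‖ := div_pos hε hD₀
  have hη₁ : ε / ‖D‖ ≤ 1 := (div_le_one hD₀).mpr hεD
  have hν := entryAverage_pos hN hN₀
  have hr := psdRank_ne_zero hN hN₀
  rw [mul_right_comm, ← Real.mul_rpow (by positivity) (by positivity),
    show 1 / 10 ^ 6 * ε / (d * m ^ 2 * ‖D‖) = ε / ‖D‖ / (10 ^ 6 * (d * m ^ 2)) by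
      field_simp] at hrank
  obtain ⟨k, hk, hkr, hkν⟩ := exists_degree_bound hm hd hn hr hη hη₁ hν
    ((entryAverage_le_norm N).trans hN₁) hrank
  obtain ⟨A, B, hA, hB, hNAB⟩ := hasPsdFactorization_psdRank N hN
  have : NeZero (psdRank N) := ⟨hr⟩
  rw [← div_mul_cancel₀ ε hD₀.ne']
  exact hD.neg_mul_norm_le_separatingFunctional hmn hA hB hNAB hN₁ hν hη hη₁ hk
    (by rwa [Fintype.card_fin]) (by rwa [Fintype.card_fin])

/-- The norms `‖D‖` and `‖N‖` are Mathlib's sup norms on functions on a finite set, that is,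
the maximal absolute value of an entry. -/
theorem mainTheorem6 :
    ∃ C : ℝ, 0 < C ∧
      ∀ m d : ℕ, 1 ≤ m → 1 ≤ d →
      ∀ ε : ℝ, 0 < ε → ε ≤ 1 →
      ∀ D : Cube m → ℝ, IsPseudoDensity d D →
      ∃ α : ℝ, 0 < α ∧
        α = (C * ε / ((d : ℝ) * (m : ℝ) ^ 2 * ‖D‖)) ^ ((d : ℝ) / 2) * (ε / ‖D‖) ^ 3 ∧
        ∀ n : ℕ, 2 * m ≤ n →
        ∀ N : SubsetOfCard n m → Cube n → ℝ,
          (∀ S x, 0 ≤ N S x) →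
          ‖N‖ ≤ 1 →
          (psdRank N : ℝ) ^ 2 / entryAverage N
            ≤ α * ((n : ℝ) / Real.log (n : ℝ)) ^ ((d : ℝ) / 2) →
          -ε ≤ separatingFunctional D N := by
  refine ⟨1 / 10 ^ 6, by norm_num, fun m d hm hd ε hε _ D hD => ⟨_, ?_, rfl, ?_⟩⟩
  · have := hD.one_le_norm
    positivity
  · exact fun n hmn N hN hN₁ => mainTheorem6_general hm hd (by lia) (by lia) hε hD hN hN₁
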